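/- Let $d\ge 1$, $\alpha=(\alpha_1,\dots,\alpha_d)\in[0,\infty)^d$, $X=(0,\infty)^d$ with Lebesgue measure, and let functions be real- or complex-valued. For $k\in\mathbb N^d$ let $$\mathcal L_k^\alpha(x)=\prod_{i=1}^d\Big(\frac{\Gamma(k_i+1)}{\Gamma(k_i+\alpha_i+1)}\Big)^{1/2}L_{k_i}^{\alpha_i}(x_i)\,x_i^{\alpha_i/2}e^{-x_i/2},\qquad x\in X,$$ be the standard Laguerre functions, where $L_n^a$ is the Laguerre polynomial of degree $n$ and order $a$. They form an orthonormal basis of $L^2(X)$ consisting of eigenfunctions of $$L_\alpha^{\mathcal L}=-\sum_{i=1}^d\Big(x_i\frac{\partial^2}{\partial x_i^2}+\frac{\partial}{\partial x_i}-\frac{x_i^2+\alpha_i^2}{4x_i}\Big),\qquad L_\alpha^{\mathcal L}\mathcal L_k^\alpha=\lambda_k\mathcal L_k^\alpha,\qquad \lambda_k=|k|+\frac{|\alpha|+d}{2},$$ where $|k|=\sum_i k_i$ and $|\alpha|=\sum_i\alpha_i$. Denote also by $L_\alpha^{\mathcal L}$ the self-adjoint extension whose spectral decomposition is given by the $\mathcal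 L_k^\alpha$, so that for $t\ge0$ $$T_t^{\alpha,\mathcal L}f=\exp(-tL_\alpha^{\mathcal L})f=\sum_{k\in\mathbb N^d}e^{-t\lambda_k}\langle f,\mathcal L_k^\alpha\rangle\,\mathcal L_k^\alpha,\qquad f\in L^2(X).$$ The action of $T_t^{\alpha,\mathcal L}$, $t>0$, extends to $L^1(X)+L^\infty(X)$ by $$T_t^{\alpha,\mathcal L}f(x)=\int_X G_t(x,y)f(y)\,dy,\qquad G_t(x,y)=\sum_{k\in\mathbb N^d}e^{-t\lambda_k}\mathcal L_k^\alpha(x)\mathcal L_k^\alpha(y),$$ the integral being absolutely convergent for all $x\in X$; put $T_0^{\alpha,\mathcal L}=\mathrm{Id}$. (Thus there is exactly one family of linear operators on $L^1(X)+L^\infty(X)$ with these properties.) Then $\{T_t^{\alpha,\mathcal L}\}_{t\ge0}$ is a submarkovian, but not Markovian, symmetric diffusion semigroup, and for every $1\le p\le\infty$ and $t>0$, $$\|T_t^{\alpha,\mathcal L}\|_{p\to p}\le\big(\cosh(t/2)\big)^{-d}.$$ Here a symmetric diffusion semigroup is a family $\{T_t\}_{t\ge0}$ of linear operators on $L^1+L^\infty$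 with $T_0=\mathrm{Id}$ such that (i) for each $1\le p\le\infty$ every $T_t$ is a contraction on $L^p$ and $\{T_t\}$ is a semigroup there, (ii) every $T_t$ is self-adjoint in $L^2$, (iii) $T_tf\to f$ in $L^2$ as $t\to0^+$ for each $f\in L^2$. It is Markovian if moreover (iv) $T_tf\ge0$ whenever $f\ge0$, and (v) $T_t\mathbf 1=\mathbf 1$ for all $t$; it is submarkovian if (iv) holds and $T_t\mathbf 1\le\mathbf 1$ for all $t$. -/

import Mathlib

open MeasureTheory Filter Topology
open scoped NNReal ENNReal ComplexOrder

section DiffusionSemigroups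

variable {X : Type*} [MeasurableSpace X]

/-- A linear operator `T`, defined on a linear space `D` of classes of measurable functions, maps
`L^p` (which has to lie in `D`) into itself, and there it is the bounded operator `A`. -/
def ActsOnLpAs {𝕜 : Type*} [RCLike 𝕜] {μ : Measure X} {D : Submodule 𝕜 (X →ₘ[μ] 𝕜)}
    (T : D →ₗ[𝕜] (X →ₘ[μ] 𝕜)) (p : ℝ≥0∞) [Fact (1 ≤ p)] (A : Lp 𝕜 p μ →L[𝕜] Lp 𝕜 p μ) : Prop :=
  ∀ f : Lp 𝕜 p μ, ∃ hf : (f : X →ₘ[μ] 𝕜) ∈ D, T ⟨f, hf⟩ = (A f : X →ₘ[μ] 𝕜)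

/-- Symmetric diffusion semigroups on a measure space, acting from a linear space `D`
that contains all the `L^p` spaces, `1 ≤ p ≤ ∞`, to classes of measurable functions. -/
structure IsSymmetricDiffusionSemigroup {𝕜 : Type*} [RCLike 𝕜] {μ : Measure X}
    {D : Submodule 𝕜 (X →ₘ[μ] 𝕜)} (T : ℝ≥0 → D →ₗ[𝕜] (X →ₘ[μ] 𝕜)) : Prop where
  /-- `T_0` is the identity. -/
  zero : T 0 = D.subtype
  /-- On each `L^p`, the operators are contractions and form a semigroup. -/
  contraction_semigroup : ∀ (p : ℝ≥0∞) [Fact (1 ≤ p)],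
    ∃ A : ℝ≥0 → (Lp 𝕜 p μ →L[𝕜] Lp 𝕜 p μ),
      (∀ t, ActsOnLpAs (T t) p (A t)) ∧ (∀ t, ‖A t‖ ≤ 1) ∧
      A 0 = ContinuousLinearMap.id 𝕜 (Lp 𝕜 p μ) ∧ ∀ s t, A (s + t) = (A s).comp (A t)
  /-- Each operator is self-adjoint in `L^2`. -/
  selfAdjoint : ∀ (t : ℝ≥0) (A : Lp 𝕜 2 μ →L[𝕜] Lp 𝕜 2 μ), ActsOnLpAs (T t) 2 A → IsSelfAdjoint A
  /-- Strong continuity at `0` in `L^2`. -/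
  tendsto_zero : ∀ A : ℝ≥0 → (Lp 𝕜 2 μ →L[𝕜] Lp 𝕜 2 μ), (∀ t, ActsOnLpAs (T t) 2 (A t)) →
    ∀ f : Lp 𝕜 2 μ, Tendsto (fun t => A t f) (𝓝[>] 0) (𝓝 f)

/-- Positive and conservative symmetric diffusion semigroups. -/
structure IsMarkovian {𝕜 : Type*} [RCLike 𝕜] {μ : Measure X}
    {D : Submodule 𝕜 (X →ₘ[μ] 𝕜)} (T : ℝ≥0 → D →ₗ[𝕜] (X →ₘ[μ] 𝕜)) : Prop
    extends IsSymmetricDiffusionSemigroup T where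
  positive : ∀ (t : ℝ≥0) (f : D), 0 ≤ (f : X →ₘ[μ] 𝕜) → 0 ≤ T t f
  conservative : ∀ t : ℝ≥0, ∃ h : (1 : X →ₘ[μ] 𝕜) ∈ D, T t ⟨1, h⟩ = 1

/-- Positive symmetric diffusion semigroups with `T_t 1 ≤ 1`. -/
structure IsSubmarkovian {𝕜 : Type*} [RCLike 𝕜] {μ : Measure X}
    {D : Submodule 𝕜 (X →ₘ[μ] 𝕜)} (T : ℝ≥0 → D →ₗ[𝕜] (X →ₘ[μ] 𝕜)) : Prop
    extends IsSymmetricDiffusionSemigroup T where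
  positive : ∀ (t : ℝ≥0) (f : D), 0 ≤ (f : X →ₘ[μ] 𝕜) → 0 ≤ T t f
  map_one_le : ∀ t : ℝ≥0, ∃ h : (1 : X →ₘ[μ] 𝕜) ∈ D, T t ⟨1, h⟩ ≤ 1

/-- The linear space `L^1 + L^∞`. -/
def L1AddLinfty (𝕜 : Type*) [RCLike 𝕜] (μ : Measure X) : Submodule 𝕜 (X →ₘ[μ] 𝕜) :=
  Lp.LpSubmodule 𝕜 𝕜 1 μ ⊔ Lp.LpSubmodule 𝕜 𝕜 ∞ μ

end DiffusionSemigroups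

section Laguerre

/-- The Laguerre polynomial `L_k^a` of degree `k` and order `a > -1`. -/
noncomputable def laguerrePoly (a : ℝ) (k : ℕ) (x : ℝ) : ℝ :=
  ∑ j ∈ Finset.range (k + 1),
    (-1) ^ j * Real.Gamma (k + a + 1) /
      (Real.Gamma (j + a + 1) * (Nat.factorial j : ℝ) * (Nat.factorial (k - j) : ℝ)) * x ^ j

/-- The standard Laguerre function of degree `k` and order `a` in one variable. -/
noncomputable def laguerreFun1 (a : ℝ) (k : ℕ) (x : ℝ) : ℝ :=
  Real.sqrt (Real.Gamma (k + 1) / Real.Gamma (k + a + 1)) * laguerrePoly a k x *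
    x ^ (a / 2) * Real.exp (-x / 2)

/-- The standard Laguerre functions in `d` variables: tensor products. -/
noncomputable def laguerreFun {d : ℕ} (α : Fin d → ℝ) (k : Fin d → ℕ) (x : Fin d → ℝ) : ℝ :=
  ∏ i, laguerreFun1 (α i) (k i) (x i)

/-- The open orthant `(0, ∞)^d`. -/
def orthant (d : ℕ) : Set (Fin d → ℝ) := {x | ∀ i, 0 < x i}

/-- Lebesgue measure on the open orthant. -/
noncomputable def orthantMeasure (d : ℕ) : Measure (Fin d → ℝ) := volume.restrict (orthant d)

/-- The Laguerre differential operator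
`-∑ i, (x_i ∂_i² + ∂_i - (x_i² + α_i²) / (4 x_i))`, applied to `u` at the point `x`. -/
noncomputable def laguerreDiffOp {d : ℕ} (α : Fin d → ℝ) (u : (Fin d → ℝ) → ℝ)
    (x : Fin d → ℝ) : ℝ :=
  -∑ i, (x i * iteratedDeriv 2 (fun s => u (Function.update x i s)) (x i) +
    deriv (fun s => u (Function.update x i s)) (x i) -
    (x i ^ 2 + α i ^ 2) / (4 * x i) * u x)

/-- The number `|k| + (|α| + d) / 2`. -/
noncomputable def laguerreEigenvalue {d : ℕ} (α : Fin d → ℝ) (k : Fin d → ℕ) : ℝ :=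
  (∑ i, (k i : ℝ)) + ((∑ i, α i) + d) / 2

/-- `S = exp(-tL)` on `L^2((0, ∞)^d)`, where `L` is the self-adjoint extension of the Laguerre
differential operator whose spectral decomposition is given by the Laguerre functions: these form an
orthonormal basis consisting of eigenfunctions of the differential operator, and `S` is given
by the spectral theorem. -/
def IsLaguerreExp {𝕜 : Type*} [RCLike 𝕜] {d : ℕ} (α : Fin d → ℝ) (t : ℝ)
    (S : Lp 𝕜 2 (orthantMeasure d) →L[𝕜] Lp 𝕜 2 (orthantMeasure d)) : Prop :=
  (∀ k, ∀ x ∈ orthant d,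
      laguerreDiffOp α (laguerreFun α k) x = laguerreEigenvalue α k * laguerreFun α k x) ∧
  ∃ b : HilbertBasis (Fin d → ℕ) 𝕜 (Lp 𝕜 2 (orthantMeasure d)),
    (∀ k, (b k : (Fin d → ℝ) → 𝕜) =ᵐ[orthantMeasure d] fun x => (laguerreFun α k x : 𝕜)) ∧
    ∀ f, HasSum
      (fun k => (Real.exp (-t * laguerreEigenvalue α k) : 𝕜) • (inner 𝕜 (b k) f) • b k) (S f)

/-- The heat kernel `G_t(x, y) = ∑ k, exp(-t (|k| + (|α| + d) / 2)) 𝓛_k(x) 𝓛_k(y)`. -/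
noncomputable def laguerreKernel {d : ℕ} (α : Fin d → ℝ) (t : ℝ) (x y : Fin d → ℝ) : ℝ :=
  ∑' k : Fin d → ℕ,
    Real.exp (-t * laguerreEigenvalue α k) * laguerreFun α k x * laguerreFun α k y

/-- `T` is the standard Laguerre function semigroup: it is `exp(-tL)` on `L^2`, and its
action on `L^1 + L^∞` is, for `t > 0`, integration against the heat kernel (with convergent
integrals at all points of the orthant), while `T_0` is the identity. -/
structure IsLaguerreSemigroup {𝕜 : Type*} [RCLike 𝕜] {d : ℕ} (α : Fin d → ℝ)
    (T : ℝ≥0 → L1AddLinfty 𝕜 (orthantMeasure d) →ₗ[𝕜] ((Fin d → ℝ) →ₘ[orthantMeasure d] 𝕜)) :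
    Prop where
  zero : T 0 = (L1AddLinfty 𝕜 (orthantMeasure d)).subtype
  exp_on_L2 : ∀ t : ℝ≥0, ∃ S : Lp 𝕜 2 (orthantMeasure d) →L[𝕜] Lp 𝕜 2 (orthantMeasure d),
    ActsOnLpAs (T t) 2 S ∧ IsLaguerreExp α t S
  integrable_kernel : ∀ t : ℝ≥0, 0 < t → ∀ f : L1AddLinfty 𝕜 (orthantMeasure d),
    ∀ x ∈ orthant d, Integrable
      (fun y => (laguerreKernel α t x y : 𝕜) * (f : (Fin d → ℝ) →ₘ[orthantMeasure d] 𝕜) y)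
      (orthantMeasure d)
  eq_integral : ∀ t : ℝ≥0, 0 < t → ∀ f : L1AddLinfty 𝕜 (orthantMeasure d),
    (T t f : (Fin d → ℝ) → 𝕜) =ᵐ[orthantMeasure d] fun x =>
      ∫ y, (laguerreKernel α t x y : 𝕜) * (f : (Fin d → ℝ) →ₘ[orthantMeasure d] 𝕜) y
        ∂(orthantMeasure d)

end Laguerre

/-! ### The one-dimensional Laguerre functions: differential equation -/

/-! Everything rests on a closed form of the heat kernel. By the Hille–Hardy formula the series
defining it in one variable equals `laguerreHeat`: with `S = sinh (t/2)` and `C = cosh (t/2)`, it is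
`(2S)⁻¹ I_a(√(xy)/S) exp (-(C/S)(x+y)/2)`, where `I_a` is the modified Bessel function. This is
visibly symmetric and nonnegative, which the series is not. In `d` variables the kernel is the
product of such factors.

Two bounds on the one-dimensional kernel suffice. It is at most `(2S)⁻¹`, so integrals against `L^1`
functions converge; and its mass in `y` is at most `1/C`, which handles `L^∞`. Both come from
`sum_rpow_div_Gamma_le_exp`, that is `∑ z^(m+b)/Γ(m+b+1) ≤ e^z` for `b = a/2 ≥ 0`, combined with the
log-convexity estimate `Γ(m+b+1)² ≤ m! Γ(m+a+1)` of `Gamma_sq_le`. For the mass, termwise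
integration of the Bessel series yields `C⁻¹ exp (-(C/S)x/2 + x/(2SC))`, and the exponent is
nonpositive because `C ≥ 1`.

The Schur test for a symmetric nonnegative kernel with marginal mass at most `C^(-d)` then bounds
the norm on every `L^p` by `C^(-d)` (`IsSchurKernel.eLpNorm_kernelIntegral_le`). Contractivity,
positivity and `T_t 1 ≤ 1` follow, and since `C^(-d) < 1` for `d ≥ 1`, `t > 0`, the constant
function is not preserved.

The rest is spectral. The Laguerre functions are eigenfunctions by the Laguerre equation, and
orthonormal because pairing `L_k` with monomials produces `k`-th finite differences of polynomials.
They are complete because their generating function turns orthogonality to all of them into the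
vanishing of all integrals against exponentials `exp (-n·y)`, which determine a finite measure on
the orthant. Orthonormality gives the Chapman–Kolmogorov identity, hence the semigroup law;
diagonality in this basis gives the spectral formula, self-adjointness and strong continuity. The
kernel formula determines the family for `t > 0`, so it is unique. -/

theorem Gamma_add_natCast_eq {c : ℝ} (hc : 0 < c) (n : ℕ) :
    Real.Gamma (c + n) = Real.Gamma c * (ascPochhammer ℝ n).eval c := by
  induction n with
  | zero => simp
  | succ n ih =>
    have h : c + n ≠ 0 := by positivity
    rw [ascPochhammer_succ_eval, ← mul_assoc, ← ih, Nat.cast_succ, ← add_assoc,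
      Real.Gamma_add_one h]
    ring

/-- The coefficients of the Laguerre polynomial of degree `k`. -/
noncomputable def laguerreCoeff (a : ℝ) (k j : ℕ) : ℝ :=
  (-1) ^ j * Real.Gamma (k + a + 1) /
    (Real.Gamma (j + a + 1) * (Nat.factorial j : ℝ) * (Nat.factorial (k - j) : ℝ))

/-- The Laguerre polynomial as an element of `ℝ[X]`. -/
noncomputable def laguerrePolynomial (a : ℝ) (k : ℕ) : Polynomial ℝ :=
  ∑ j ∈ Finset.range (k + 1), Polynomial.monomial j (laguerreCoeff a k j)

theorem eval_laguerrePolynomial (a : ℝ) (k : ℕ) (x : ℝ) :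
    (laguerrePolynomial a k).eval x = laguerrePoly a k x := by
  simp [laguerrePolynomial, laguerrePoly, Polynomial.eval_finsetSum, laguerreCoeff]

theorem coeff_laguerrePolynomial (a : ℝ) (k j : ℕ) :
    (laguerrePolynomial a k).coeff j = if j ≤ k then laguerreCoeff a k j else 0 := by
  simp [laguerrePolynomial, Polynomial.coeff_monomial]

theorem laguerreCoeff_succ {a : ℝ} (ha : 0 ≤ a) {k j : ℕ} (hj : j < k) :
    (j + 1) * (j + a + 1) * laguerreCoeff a k (j + 1) = -(k - j) * laguerreCoeff a k j := by
  obtain ⟨m, rfl⟩ : ∃ m, k = j + 1 + m := ⟨k - (j + 1), by omega⟩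
  have e1 : j + 1 + m - (j + 1) = m := by omega
  have e2 : j + 1 + m - j = m + 1 := by omega
  have e3 : ((j + 1 : ℕ) : ℝ) + a + 1 = (j + a + 1) + 1 := by push_cast; ring
  have hp : (0 : ℝ) < j + a + 1 := by positivity
  have hg := Real.Gamma_pos_of_pos hp
  simp only [laguerreCoeff]
  rw [e1, e2, e3, Real.Gamma_add_one hp.ne', Nat.factorial_succ j, Nat.factorial_succ m]
  push_cast
  have h1 : (Nat.factorial j : ℝ) ≠ 0 := by positivity
  have h2 : (Nat.factorial m : ℝ) ≠ 0 := by positivity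
  field_simp
  ring

/-- Comparing coefficients of `X ^ n` turns the equation into the two-term recurrence of
`laguerreCoeff_succ`. It persists at `n = k`, where the factor `k - n` vanishes, and beyond, where
both coefficients do. -/
theorem laguerrePolynomial_ode {a : ℝ} (ha : 0 ≤ a) (k : ℕ) :
    Polynomial.X * Polynomial.derivative (Polynomial.derivative (laguerrePolynomial a k)) +
      (Polynomial.C (a + 1) - Polynomial.X) * Polynomial.derivative (laguerrePolynomial a k) +
      Polynomial.C (k : ℝ) * laguerrePolynomial a k = 0 := by
  ext n
  have key : ((n : ℝ) + 1) * (n + a + 1) * (laguerrePolynomial a k).coeff (n + 1) =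
      -(k - n) * (laguerrePolynomial a k).coeff n := by
    simp only [coeff_laguerrePolynomial]
    rcases lt_trichotomy n k with h | h | h
    · rw [if_pos (by omega), if_pos h.le, laguerreCoeff_succ ha h]
    · subst h; simp
    · rw [if_neg (by omega), if_neg (by omega)]; simp
  cases n with
  | zero =>
    simp [sub_mul, Polynomial.coeff_derivative] at key ⊢
    linarith
  | succ n =>
    simp [sub_mul, add_mul, Polynomial.coeff_derivative, Polynomial.coeff_X_mul] at key ⊢
    linarith

/-- Differentiation preserves the shape `g(s) s^b exp (-s/2)`, replacing `g` by `g' + g (b/s -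
1/2)`; applying this twice gives the second derivative of a Laguerre function. -/
theorem hasDerivAt_mul_rpow_mul_exp {g : ℝ → ℝ} {g' x : ℝ} (b : ℝ) (hx : 0 < x)
    (hg : HasDerivAt g g' x) :
    HasDerivAt (fun s => g s * s ^ b * Real.exp (-s / 2))
      ((g' + g x * (b / x - 1 / 2)) * x ^ b * Real.exp (-x / 2)) x := by
  have h1 : HasDerivAt (fun s : ℝ => s ^ b) (b * x ^ (b - 1)) x :=
    Real.hasDerivAt_rpow_const (Or.inl hx.ne')
  have h2 : HasDerivAt (fun s : ℝ => Real.exp (-s / 2)) (Real.exp (-x / 2) * (-1 / 2)) x :=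
    ((hasDerivAt_id x).neg.div_const 2).exp
  refine ((hg.mul h1).mul h2).congr_deriv ?_
  simp only [Pi.mul_apply]
  rw [Real.rpow_sub_one hx.ne']
  field_simp
  ring

theorem laguerreFun1_eq (a : ℝ) (k : ℕ) :
    laguerreFun1 a k = fun x => Real.sqrt (Real.Gamma (k + 1) / Real.Gamma (k + a + 1)) *
      ((laguerrePolynomial a k).eval x * x ^ (a / 2) * Real.exp (-x / 2)) := by
  ext x
  simp only [laguerreFun1, eval_laguerrePolynomial]
  ring

theorem laguerreFun1_ode {a : ℝ} (ha : 0 ≤ a) (k : ℕ) {x : ℝ} (hx : 0 < x) :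
    x * iteratedDeriv 2 (laguerreFun1 a k) x + deriv (laguerreFun1 a k) x -
      (x ^ 2 + a ^ 2) / (4 * x) * laguerreFun1 a k x =
      -(k + (a + 1) / 2) * laguerreFun1 a k x := by
  set P := laguerrePolynomial a k with hP
  set N := Real.sqrt (Real.Gamma (k + 1) / Real.Gamma (k + a + 1)) with hN
  set g : ℝ → ℝ := fun y => (P.derivative.eval y + P.eval y * (a / 2 / y - 1 / 2)) with hg
  have hd1 : ∀ y, 0 < y → HasDerivAt (laguerreFun1 a k)
      (N * (g y * y ^ (a / 2) * Real.exp (-y / 2))) y := by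
    intro y hy
    rw [laguerreFun1_eq]
    exact (hasDerivAt_mul_rpow_mul_exp (a / 2) hy (P.hasDerivAt y)).const_mul N
  have hgd : HasDerivAt g (P.derivative.derivative.eval x +
      (P.derivative.eval x * (a / 2 / x - 1 / 2) + P.eval x * (-(a / 2) / x ^ 2))) x := by
    refine (P.derivative.hasDerivAt x).add ((P.hasDerivAt x).mul ?_)
    have : HasDerivAt (fun y => a / 2 / y - 1 / 2) _ x :=
      ((hasDerivAt_const x (a / 2)).div (hasDerivAt_id x) hx.ne').sub_const (1 / 2)
    refine this.congr_deriv ?_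
    simp
  have hd2 : iteratedDeriv 2 (laguerreFun1 a k) x = N * ((P.derivative.derivative.eval x +
      (P.derivative.eval x * (a / 2 / x - 1 / 2) + P.eval x * (-(a / 2) / x ^ 2)) +
      g x * (a / 2 / x - 1 / 2)) * x ^ (a / 2) * Real.exp (-x / 2)) := by
    rw [iteratedDeriv_succ, iteratedDeriv_one]
    have : deriv (laguerreFun1 a k) =ᶠ[𝓝 x]
        fun y => N * (g y * y ^ (a / 2) * Real.exp (-y / 2)) := by
      filter_upwards [lt_mem_nhds hx] with y hy using (hd1 y hy).deriv
    rw [this.deriv_eq]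
    exact ((hasDerivAt_mul_rpow_mul_exp (a / 2) hx hgd).const_mul N).deriv
  rw [hd2, (hd1 x hx).deriv, laguerreFun1_eq]
  have ode := congrArg (Polynomial.eval x) (laguerrePolynomial_ode ha k)
  simp only [Polynomial.eval_add, Polynomial.eval_mul, Polynomial.eval_sub, Polynomial.eval_X,
    Polynomial.eval_C, Polynomial.eval_zero, ← hP] at ode
  -- The Laguerre equation is solved for the second derivative, after which the claim is an
  -- algebraic identity in `P` and `P'`.
  have e : P.derivative.derivative.eval x =
      -((a + 1 - x) * P.derivative.eval x + k * P.eval x) / x := by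
    field_simp; linarith
  rw [e]
  simp only [hg, ← hN, ← hP]
  field_simp
  ring

theorem laguerreDiffOp_laguerreFun {d : ℕ} {α : Fin d → ℝ} (hα : ∀ i, 0 ≤ α i) (k : Fin d → ℕ)
    {x : Fin d → ℝ} (hx : x ∈ orthant d) :
    laguerreDiffOp α (laguerreFun α k) x = laguerreEigenvalue α k * laguerreFun α k x := by
  classical
  have hsplit : ∀ i s, laguerreFun α k (Function.update x i s) =
      (∏ j ∈ Finset.univ.erase i, laguerreFun1 (α j) (k j) (x j)) *
        laguerreFun1 (α i) (k i) s := by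
    intro i s
    unfold laguerreFun
    rw [← Finset.mul_prod_erase Finset.univ _ (Finset.mem_univ i), mul_comm]
    congr 1
    · refine Finset.prod_congr rfl fun j hj => ?_
      rw [Function.update_of_ne (Finset.ne_of_mem_erase hj)]
    · simp
  have hself : ∀ i, laguerreFun α k x =
      (∏ j ∈ Finset.univ.erase i, laguerreFun1 (α j) (k j) (x j)) *
        laguerreFun1 (α i) (k i) (x i) := by
    intro i
    rw [← hsplit, Function.update_eq_self]
  have hterm : ∀ i, x i * iteratedDeriv 2 (fun s => laguerreFun α k (Function.update x i s)) (x i) +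
      deriv (fun s => laguerreFun α k (Function.update x i s)) (x i) -
      (x i ^ 2 + α i ^ 2) / (4 * x i) * laguerreFun α k x =
      -(k i + (α i + 1) / 2) * laguerreFun α k x := by
    intro i
    have ode := laguerreFun1_ode (hα i) (k i) (hx i)
    simp only [hsplit]
    rw [iteratedDeriv_const_mul_field, deriv_const_mul_field, hself i]
    linear_combination (∏ j ∈ Finset.univ.erase i, laguerreFun1 (α j) (k j) (x j)) * ode
  unfold laguerreDiffOp
  rw [Finset.sum_congr rfl fun i _ => hterm i, ← Finset.sum_mul, ← neg_mul,
    ← Finset.sum_neg_distrib]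
  congr 1
  simp only [neg_neg, laguerreEigenvalue, Finset.sum_add_distrib, ← Finset.sum_div]
  simp

/-! ### The one-dimensional Laguerre functions: orthonormality -/

theorem integrableOn_pow_mul_rpow_mul_exp {a : ℝ} (ha : 0 ≤ a) (n : ℕ) :
    IntegrableOn (fun y : ℝ => y ^ n * (y ^ a * Real.exp (-y))) (Set.Ioi 0) := by
  have h := Real.GammaIntegral_convergent (s := n + a + 1) (by positivity)
  refine h.congr_fun (fun y hy => ?_) measurableSet_Ioi
  have hy : 0 < y := hy
  simp only [add_sub_cancel_right]
  rw [Real.rpow_add hy, Real.rpow_natCast]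
  ring

theorem integral_pow_mul_rpow_mul_exp {a : ℝ} (ha : 0 ≤ a) (n : ℕ) :
    ∫ y in Set.Ioi (0 : ℝ), y ^ n * (y ^ a * Real.exp (-y)) = Real.Gamma (n + a + 1) := by
  rw [Real.Gamma_eq_integral (by positivity)]
  refine setIntegral_congr_fun measurableSet_Ioi fun y hy => ?_
  have hy : 0 < y := hy
  simp only [add_sub_cancel_right]
  rw [Real.rpow_add hy, Real.rpow_natCast]
  ring

theorem integrableOn_eval_mul_rpow_mul_exp {a : ℝ} (ha : 0 ≤ a) (Q : Polynomial ℝ) :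
    IntegrableOn (fun y : ℝ => Q.eval y * (y ^ a * Real.exp (-y))) (Set.Ioi 0) := by
  simp only [Polynomial.eval_eq_sum_range, Finset.sum_mul, mul_assoc]
  exact integrable_finsetSum _ fun n _ => (integrableOn_pow_mul_rpow_mul_exp ha n).const_mul _

theorem integral_eval_mul_rpow_mul_exp {a : ℝ} (ha : 0 ≤ a) (Q : Polynomial ℝ) {n : ℕ}
    (hn : Q.natDegree < n) :
    ∫ y in Set.Ioi (0 : ℝ), Q.eval y * (y ^ a * Real.exp (-y)) =
      ∑ j ∈ Finset.range n, Q.coeff j * Real.Gamma (j + a + 1) := by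
  simp only [Polynomial.eval_eq_sum_range' hn, Finset.sum_mul, mul_assoc]
  rw [integral_finsetSum _ fun n _ => (integrableOn_pow_mul_rpow_mul_exp ha n).const_mul _]
  simp only [integral_const_mul, integral_pow_mul_rpow_mul_exp ha]

/-- `Γ(i+j+a+1)/Γ(j+a+1)` is a rising factorial, hence a polynomial of degree `i` in `j`. What
remains of the coefficient is a signed binomial, so the sum over `j` becomes a `k`-th finite
difference of that polynomial. -/
theorem laguerreCoeff_mul_Gamma {a : ℝ} (ha : 0 ≤ a) (i : ℕ) {k j : ℕ} (hj : j ≤ k) :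
    laguerreCoeff a k j * Real.Gamma ((i + j : ℕ) + a + 1) =
      Real.Gamma (k + a + 1) / Nat.factorial k * (-1) ^ k *
        ((-1) ^ (k - j) * (k.choose j : ℝ) * (ascPochhammer ℝ i).eval (j + (a + 1))) := by
  have hp : (0 : ℝ) < j + a + 1 := by positivity
  have hg := (Real.Gamma_pos_of_pos hp).ne'
  have e : ((i + j : ℕ) : ℝ) + a + 1 = (j + a + 1) + i := by push_cast; ring
  rw [e, Gamma_add_natCast_eq hp, Nat.cast_choose ℝ hj, laguerreCoeff, ← add_assoc]
  have h1 : (Nat.factorial j : ℝ) ≠ 0 := by positivity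
  have h2 : (Nat.factorial k : ℝ) ≠ 0 := by positivity
  have h3 : (Nat.factorial (k - j) : ℝ) ≠ 0 := by positivity
  have hs : (-1 : ℝ) ^ j = (-1) ^ k * (-1) ^ (k - j) := by
    rw [← pow_add, ← Nat.add_sub_cancel' hj, Nat.add_sub_cancel_left,
      show j + (k - j) + (k - j) = j + 2 * (k - j) by ring, pow_add, pow_mul]
    simp
  rw [hs]
  field_simp

theorem sum_laguerreCoeff_mul_Gamma {a : ℝ} (ha : 0 ≤ a) (i k : ℕ) :
    ∑ j ∈ Finset.range (k + 1), laguerreCoeff a k j * Real.Gamma ((i + j : ℕ) + a + 1) =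
      Real.Gamma (k + a + 1) / Nat.factorial k * (-1) ^ k *
        ((fwdDiff (1 : ℝ))^[k] (fun x => ((ascPochhammer ℝ i).comp
          (Polynomial.X + Polynomial.C (a + 1))).eval x)) 0 := by
  rw [fwdDiff_iter_eq_sum_shift, Finset.mul_sum]
  refine Finset.sum_congr rfl fun j hj => ?_
  rw [laguerreCoeff_mul_Gamma ha i (by simpa [Nat.lt_succ_iff] using hj)]
  simp [zsmul_eq_mul]

theorem natDegree_ascPochhammer_comp (i : ℕ) (c : ℝ) :
    ((ascPochhammer ℝ i).comp (Polynomial.X + Polynomial.C c)).natDegree = i := by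
  rw [Polynomial.natDegree_comp, ascPochhammer_natDegree, Polynomial.natDegree_X_add_C, mul_one]

theorem sum_laguerreCoeff_mul_Gamma_of_lt {a : ℝ} (ha : 0 ≤ a) {i k : ℕ} (hik : i < k) :
    ∑ j ∈ Finset.range (k + 1), laguerreCoeff a k j * Real.Gamma ((i + j : ℕ) + a + 1) = 0 := by
  rw [sum_laguerreCoeff_mul_Gamma ha, Polynomial.fwdDiff_iter_eq_zero_of_degree_lt
    (by rwa [natDegree_ascPochhammer_comp])]
  simp

theorem sum_laguerreCoeff_mul_Gamma_self {a : ℝ} (ha : 0 ≤ a) (k : ℕ) :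
    ∑ j ∈ Finset.range (k + 1), laguerreCoeff a k j * Real.Gamma ((k + j : ℕ) + a + 1) =
      Real.Gamma (k + a + 1) * (-1) ^ k := by
  have h := Polynomial.fwdDiff_iter_degree_eq_factorial
    ((ascPochhammer ℝ k).comp (Polynomial.X + Polynomial.C (a + 1)))
  have hm : ((ascPochhammer ℝ k).comp (Polynomial.X + Polynomial.C (a + 1))).Monic :=
    (monic_ascPochhammer ℝ k).comp_X_add_C _
  rw [natDegree_ascPochhammer_comp, hm.leadingCoeff] at h
  rw [sum_laguerreCoeff_mul_Gamma ha, h]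
  have h1 : (Nat.factorial k : ℝ) ≠ 0 := by positivity
  simp
  field_simp

theorem natDegree_laguerrePolynomial_lt (a : ℝ) (k : ℕ) :
    (laguerrePolynomial a k).natDegree < k + 1 := by
  rw [Nat.lt_succ_iff, Polynomial.natDegree_le_iff_coeff_eq_zero]
  intro n hn
  rw [coeff_laguerrePolynomial, if_neg (by omega)]

theorem integral_pow_mul_laguerrePolynomial {a : ℝ} (ha : 0 ≤ a) (i k : ℕ) :
    ∫ y in Set.Ioi (0 : ℝ), (Polynomial.X ^ i * laguerrePolynomial a k).eval y *
      (y ^ a * Real.exp (-y)) =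
      ∑ j ∈ Finset.range (k + 1), laguerreCoeff a k j * Real.Gamma ((i + j : ℕ) + a + 1) := by
  have hdeg : (Polynomial.X ^ i * laguerrePolynomial a k).natDegree < i + (k + 1) := by
    refine Polynomial.natDegree_mul_le.trans_lt ?_
    rw [Polynomial.natDegree_X_pow]
    have := natDegree_laguerrePolynomial_lt a k
    omega
  rw [integral_eval_mul_rpow_mul_exp ha _ hdeg, Finset.sum_range_add, Finset.sum_eq_zero, zero_add]
  · refine Finset.sum_congr rfl fun j hj => ?_
    rw [Polynomial.coeff_X_pow_mul', if_pos (by omega), coeff_laguerrePolynomial,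
      if_pos (by have := Finset.mem_range.1 hj; omega), Nat.add_sub_cancel_left]
  · intro j hj
    rw [Polynomial.coeff_X_pow_mul', if_neg (by have := Finset.mem_range.1 hj; omega), zero_mul]

/-- Expanding the polynomial of lower degree in monomials leaves only moments `X ^ i` with `i ≤ k`.
All those with `i < k` vanish, so a contribution survives only from the leading term when `l = k`.
-/
theorem integral_laguerrePolynomial_mul {a : ℝ} (ha : 0 ≤ a) {l k : ℕ} (hlk : l ≤ k) :
    ∫ y in Set.Ioi (0 : ℝ), (laguerrePolynomial a l).eval y * (laguerrePolynomial a k).eval y *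
      (y ^ a * Real.exp (-y)) =
      if l = k then Real.Gamma (k + a + 1) / Nat.factorial k else 0 := by
  have h : ∀ y, (laguerrePolynomial a l).eval y * (laguerrePolynomial a k).eval y *
      (y ^ a * Real.exp (-y)) = ∑ i ∈ Finset.range (l + 1), laguerreCoeff a l i *
        ((Polynomial.X ^ i * laguerrePolynomial a k).eval y * (y ^ a * Real.exp (-y))) := by
    intro y
    rw [Polynomial.eval_eq_sum_range' (natDegree_laguerrePolynomial_lt a l), Finset.sum_mul,
      Finset.sum_mul]
    refine Finset.sum_congr rfl fun i hi => ?_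
    rw [coeff_laguerrePolynomial, if_pos (by have := Finset.mem_range.1 hi; omega)]
    simp only [Polynomial.eval_mul, Polynomial.eval_pow, Polynomial.eval_X]
    ring
  simp only [h]
  rw [integral_finsetSum _ fun i _ => (integrableOn_eval_mul_rpow_mul_exp ha _).const_mul _]
  simp only [integral_const_mul, integral_pow_mul_laguerrePolynomial ha]
  split_ifs with hl
  · subst hl
    rw [Finset.sum_range_succ, Finset.sum_eq_zero, zero_add, sum_laguerreCoeff_mul_Gamma_self ha]
    · have h1 : (Nat.factorial l : ℝ) ≠ 0 := by positivity
      have h2 := (Real.Gamma_pos_of_pos (show (0 : ℝ) < l + a + 1 by positivity)).ne'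
      have h3 : ((-1 : ℝ) ^ l) * (-1) ^ l = 1 := by rw [← mul_pow]; simp
      simp only [laguerreCoeff, Nat.sub_self, Nat.factorial_zero, Nat.cast_one]
      field_simp
      linear_combination h3
    · intro i hi
      rw [sum_laguerreCoeff_mul_Gamma_of_lt ha (Finset.mem_range.1 hi), mul_zero]
  · refine Finset.sum_eq_zero fun i hi => ?_
    rw [sum_laguerreCoeff_mul_Gamma_of_lt ha (by have := Finset.mem_range.1 hi; omega), mul_zero]

theorem laguerreFun1_mul_laguerreFun1 (a : ℝ) (k l : ℕ) {y : ℝ} (hy : 0 < y) :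
    laguerreFun1 a k y * laguerreFun1 a l y =
      (Real.sqrt (Real.Gamma (k + 1) / Real.Gamma (k + a + 1)) *
        Real.sqrt (Real.Gamma (l + 1) / Real.Gamma (l + a + 1))) *
      ((laguerrePolynomial a k).eval y * (laguerrePolynomial a l).eval y *
        (y ^ a * Real.exp (-y))) := by
  have e1 : y ^ a = y ^ (a / 2) * y ^ (a / 2) := by rw [← Real.rpow_add hy, add_halves]
  have e2 : Real.exp (-y) = Real.exp (-y / 2) * Real.exp (-y / 2) := by
    rw [← Real.exp_add, add_halves]
  rw [e1, e2]
  simp only [laguerreFun1, eval_laguerrePolynomial]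
  ring

theorem integrableOn_laguerreFun1_mul {a : ℝ} (ha : 0 ≤ a) (k l : ℕ) :
    IntegrableOn (fun y => laguerreFun1 a k y * laguerreFun1 a l y) (Set.Ioi 0) := by
  refine IntegrableOn.congr_fun ?_
    (fun y hy => (laguerreFun1_mul_laguerreFun1 a k l hy).symm) measurableSet_Ioi
  simp only [← Polynomial.eval_mul]
  exact (integrableOn_eval_mul_rpow_mul_exp ha _).const_mul _

theorem integral_laguerreFun1_mul {a : ℝ} (ha : 0 ≤ a) (k l : ℕ) :
    ∫ y in Set.Ioi (0 : ℝ), laguerreFun1 a k y * laguerreFun1 a l y = if k = l then 1 else 0 := by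
  wlog hkl : k ≤ l generalizing k l
  · simp only [mul_comm (laguerreFun1 a k _), this l k (by omega), eq_comm]
  rw [setIntegral_congr_fun measurableSet_Ioi
    fun y hy => laguerreFun1_mul_laguerreFun1 a k l hy, integral_const_mul,
    integral_laguerrePolynomial_mul ha hkl]
  split_ifs with h
  · subst h
    have h2 := Real.Gamma_pos_of_pos (show (0 : ℝ) < k + a + 1 by positivity)
    have h1 : (0 : ℝ) < Nat.factorial k := by positivity
    rw [Real.Gamma_nat_eq_factorial, Real.mul_self_sqrt (by positivity)]
    field_simp
  · simp

theorem measurable_laguerreFun1 (a : ℝ) (k : ℕ) : Measurable (laguerreFun1 a k) := by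
  rw [laguerreFun1_eq]
  have := (laguerrePolynomial a k).continuous.measurable
  fun_prop

/-! ### Generating functions -/

/-- This is the binomial series: `Γ(n+c)/Γ(c)` is the rising factorial of `c`. -/
theorem hasSum_Gamma_div_factorial_mul_pow {c s : ℝ} (hc : 0 < c) (hs : |s| < 1) :
    HasSum (fun n : ℕ => Real.Gamma (n + c) / Nat.factorial n * s ^ n)
      (Real.Gamma c * (1 - s) ^ (-c)) := by
  have hmem : s ∈ Metric.eball (0 : ℝ) 1 := by
    simpa [Metric.mem_eball, edist_dist, dist_zero_right] using hs
  have h := ((Real.one_div_one_sub_rpow_hasFPowerSeriesOnBall_zero c).hasSum hmem).mul_left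
    (Real.Gamma c)
  have h1s : 0 ≤ 1 - s := by linarith [(abs_lt.1 hs).2]
  simp only [FormalMultilinearSeries.ofScalars_apply_eq, zero_add, smul_eq_mul, one_div] at h
  rw [Real.rpow_neg h1s]
  refine h.congr_fun fun n => ?_
  have h2 : (Nat.factorial n : ℝ) * Ring.choose (c + n - 1) n = (ascPochhammer ℝ n).eval c := by
    have := Ring.factorial_nsmul_multichoose_eq_ascPochhammer c n
    rw [nsmul_eq_mul, Polynomial.ascPochhammer_smeval_eq_eval] at this
    rw [← this, Ring.multichoose_eq]
  have h3 : (Nat.factorial n : ℝ) ≠ 0 := by positivity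
  rw [add_comm (n : ℝ) c, Gamma_add_natCast_eq hc, ← h2]
  field_simp

theorem hasSum_sum_range_of_summable_prod {F : ℕ × ℕ → ℝ} {S : ℝ} (hF : HasSum F S) :
    HasSum (fun n => ∑ j ∈ Finset.range (n + 1), F (j, n - j)) S := by
  have h := (Finset.HasAntidiagonal.sigmaAntidiagonalEquivProd.hasSum_iff (f := F)).2 hF
  refine (h.sigma fun n => hasSum_fintype _).congr_fun fun n => ?_
  rw [← Finset.Nat.sum_antidiagonal_eq_sum_range_succ_mk, Finset.univ_eq_attach]
  exact (Finset.sum_attach _ (fun p => F p)).symm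


/-- It bounds the normalising factors `n!/Γ(n+a+1)` uniformly by `1/Γ(a+1)`, and is used only to
dominate series. -/
theorem factorial_mul_Gamma_le {a : ℝ} (ha : 0 ≤ a) (n : ℕ) :
    Nat.factorial n * Real.Gamma (a + 1) ≤ Real.Gamma (n + a + 1) := by
  induction n with
  | zero => simp
  | succ n ih =>
    have hp : (0 : ℝ) < n + a + 1 := by positivity
    have e : ((n + 1 : ℕ) : ℝ) + a + 1 = (n + a + 1) + 1 := by push_cast; ring
    rw [e, Real.Gamma_add_one hp.ne', Nat.factorial_succ]
    push_cast
    have hg := Real.Gamma_pos_of_pos (show 0 < a + 1 by positivity)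
    calc ((n : ℝ) + 1) * Nat.factorial n * Real.Gamma (a + 1)
        = (n + 1) * (Nat.factorial n * Real.Gamma (a + 1)) := by ring
      _ ≤ (n + a + 1) * Real.Gamma (n + a + 1) := by gcongr; linarith

theorem Gamma_natCast_add_pos {a : ℝ} (ha : 0 ≤ a) (n : ℕ) : 0 < Real.Gamma (n + a + 1) :=
  Real.Gamma_pos_of_pos (by positivity)

/-- The coefficients alternate in sign, so at `-|x|` every term is nonnegative. The generating
function at `-|x|` thereby serves as a majorant for absolute convergence. -/
theorem abs_laguerrePoly_le {a : ℝ} (ha : 0 ≤ a) (n : ℕ) (x : ℝ) :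
    |laguerrePoly a n x| ≤ laguerrePoly a n (-|x|) := by
  unfold laguerrePoly
  refine (Finset.abs_sum_le_sum_abs _ _).trans (Finset.sum_le_sum fun j _ => ?_)
  have h1 := Gamma_natCast_add_pos ha n
  have h2 := Gamma_natCast_add_pos ha j
  rw [abs_mul, abs_div, abs_mul, abs_pow, abs_neg, abs_one, one_pow, abs_pow, one_mul,
    abs_of_pos h1, abs_of_pos (by positivity), mul_div_right_comm, neg_pow |x|]
  rw [show ∀ u v w : ℝ, u * v * (w * |x| ^ j) = (u * w) * (v * |x| ^ j) from fun _ _ _ => by ring]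
  have h3 : (-1 : ℝ) ^ j * (-1) ^ j = 1 := by rw [← mul_pow]; simp
  refine le_of_eq ?_
  linear_combination -(Real.Gamma (n + a + 1) * |x| ^ j /
    (Real.Gamma (j + a + 1) * Nat.factorial j * Nat.factorial (n - j))) * h3

/-- The double series `F` has rows (fixed `j`) summed by the binomial series and row sums forming an
exponential series; its antidiagonal sums are `L_n(x) s^n`. -/
theorem hasSum_laguerrePoly_mul_pow {a : ℝ} (ha : 0 ≤ a) (x : ℝ) {s : ℝ} (hs : |s| < 1) :
    HasSum (fun n => laguerrePoly a n x * s ^ n)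
      ((1 - s) ^ (-(a + 1)) * Real.exp (-(x * s / (1 - s)))) := by
  set F : ℝ → ℝ → ℕ × ℕ → ℝ := fun x s p => (-x * s) ^ p.1 / Nat.factorial p.1 /
    Real.Gamma (p.1 + a + 1) * (Real.Gamma (p.2 + (p.1 + a + 1)) / Nat.factorial p.2 * s ^ p.2)
    with hF
  have row : ∀ x s : ℝ, |s| < 1 → ∀ j : ℕ, HasSum (fun m => F x s (j, m))
      ((1 - s) ^ (-(a + 1)) * ((-(x * s / (1 - s))) ^ j / Nat.factorial j)) := by
    intro x s hs j
    have h1s : 0 < 1 - s := by linarith [(abs_lt.1 hs).2]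
    have hp := Gamma_natCast_add_pos ha j
    have h := (hasSum_Gamma_div_factorial_mul_pow (c := j + a + 1) (by positivity) hs).mul_left
      ((-x * s) ^ j / Nat.factorial j / Real.Gamma (j + a + 1))
    suffices e : (1 - s) ^ (-(a + 1)) * ((-(x * s / (1 - s))) ^ j / Nat.factorial j) =
        (-x * s) ^ j / Nat.factorial j / Real.Gamma (j + a + 1) *
          (Real.Gamma (j + a + 1) * (1 - s) ^ (-((j : ℝ) + a + 1))) by
      rw [e]; exact h
    rw [show -((j : ℝ) + a + 1) = -(a + 1) - j by ring, Real.rpow_sub_natCast h1s.ne',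
      show -(x * s / (1 - s)) = (-x * s) / (1 - s) by ring, div_pow]
    field_simp
  have hexp : ∀ z : ℝ, HasSum (fun j : ℕ => z ^ j / Nat.factorial j) (Real.exp z) := by
    intro z
    rw [Real.exp_eq_exp_ℝ]
    exact NormedSpace.expSeries_div_hasSum_exp z
  have tot : ∀ x s : ℝ, |s| < 1 → HasSum (fun j : ℕ => (1 - s) ^ (-(a + 1)) *
      ((-(x * s / (1 - s))) ^ j / Nat.factorial j))
      ((1 - s) ^ (-(a + 1)) * Real.exp (-(x * s / (1 - s)))) := fun x s _ => (hexp _).mul_left _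
  have habs : |(|s|)| < 1 := by rwa [abs_abs]
  have hnn : 0 ≤ F (-|x|) |s| := by
    intro p
    have h1 := Gamma_natCast_add_pos ha p.1
    have h2 : 0 < Real.Gamma (p.2 + (p.1 + a + 1)) := Real.Gamma_pos_of_pos (by positivity)
    simp only [hF, neg_neg, Pi.zero_apply]
    positivity
  -- The absolute value of `F x s` is exactly `F (-|x|) |s|`, whose terms are nonnegative and whose
  -- iterated sum is already known.
  have hsum : Summable (F x s) := by
    have : Summable (F (-|x|) |s|) := by
      rw [summable_prod_of_nonneg hnn]
      refine ⟨fun j => (row (-|x|) |s| habs j).summable, ?_⟩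
      simp only [fun j => (row (-|x|) |s| habs j).tsum_eq]
      exact (tot (-|x|) |s| habs).summable
    refine this.of_norm_bounded fun p => le_of_eq ?_
    have h1 := Gamma_natCast_add_pos ha p.1
    have h2 : 0 < Real.Gamma (p.2 + (p.1 + a + 1)) := Real.Gamma_pos_of_pos (by positivity)
    simp only [hF, norm_mul, norm_div, norm_pow, Real.norm_eq_abs, abs_neg, neg_neg,
      abs_of_pos h1, abs_of_pos h2, Nat.abs_cast]
  have hval := hsum.hasSum
  have e := (hval.prod_fiberwise (row x s hs)).unique (tot x s hs)
  rw [e] at hval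
  refine (hasSum_sum_range_of_summable_prod hval).congr_fun fun n => ?_
  rw [laguerrePoly, Finset.sum_mul]
  refine Finset.sum_congr rfl fun j hj => ?_
  obtain ⟨m, rfl⟩ : ∃ m, n = j + m := ⟨n - j, by have := Finset.mem_range.1 hj; omega⟩
  have h1 := Gamma_natCast_add_pos ha j
  simp only [hF, Nat.add_sub_cancel_left]
  rw [show ((j + m : ℕ) : ℝ) + a + 1 = m + (j + a + 1) by push_cast; ring, pow_add, mul_pow,
    neg_pow x]
  field_simp

theorem summable_abs_laguerrePoly_mul_pow {a : ℝ} (ha : 0 ≤ a) (x : ℝ) {s : ℝ} (hs0 : 0 ≤ s)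
    (hs : s < 1) : Summable fun n => |laguerrePoly a n x| * s ^ n := by
  have h := (hasSum_laguerrePoly_mul_pow ha (-|x|) (s := s) (by rwa [abs_of_nonneg hs0])).summable
  refine h.of_nonneg_of_le (fun n => by positivity) fun n => ?_
  gcongr
  exact abs_laguerrePoly_le ha n x

/-- Both series are power series of the same function at `0`, and such a series is unique. Half the
radius is taken so that convergence is known at a point on the boundary of the smaller ball. -/
theorem eq_of_hasSum_mul_pow {f g : ℕ → ℝ} {F : ℝ → ℝ} {ρ : ℝ} (hρ : 0 < ρ)
    (hf : ∀ u, |u| < ρ → HasSum (fun j => f j * u ^ j) (F u))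
    (hg : ∀ u, |u| < ρ → HasSum (fun j => g j * u ^ j) (F u)) : f = g := by
  have key : ∀ f : ℕ → ℝ, (∀ u, |u| < ρ → HasSum (fun j => f j * u ^ j) (F u)) →
      HasFPowerSeriesAt F (FormalMultilinearSeries.ofScalars ℝ f) 0 := by
    intro f hf
    set R : ℝ≥0 := ⟨ρ / 2, by positivity⟩ with hR
    have hRρ : (R : ℝ) = ρ / 2 := rfl
    refine ⟨R, HasFPowerSeriesOnBall.mk ?_ ?_ ?_⟩
    · refine FormalMultilinearSeries.le_radius_of_tendsto _ (l := 0) ?_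
      have h := (hf (ρ / 2) (by rw [abs_of_pos (by positivity)]; linarith)).summable
      have h' := h.tendsto_atTop_zero.norm
      rw [norm_zero] at h'
      refine h'.congr fun n => ?_
      rw [FormalMultilinearSeries.ofScalars_norm, norm_mul, norm_pow, hRρ,
        Real.norm_of_nonneg (show 0 ≤ ρ / 2 by positivity)]
    · exact ENNReal.coe_pos.2 (by rw [← NNReal.coe_pos, hRρ]; positivity)
    · intro y hy
      have hy' : |y| < ρ := by
        rw [Metric.mem_eball, edist_dist, dist_zero_right,
          ENNReal.ofReal_lt_coe_iff (norm_nonneg _), hRρ, Real.norm_eq_abs] at hy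
        linarith
      simpa [FormalMultilinearSeries.ofScalars_apply_eq, mul_comm] using hf y hy'
  have h := (key f hf).eq_formalMultilinearSeries (key g hg)
  exact FormalMultilinearSeries.ofScalars_series_injective ℝ ℝ h

/-! ### The Hille–Hardy formula -/

/-- The left side is the coefficient of `u^j` in the generating function evaluated at `r(1+u)`.
Since `1 - r(1+u) = (1-r)(1-v)` with `v = ru/(1-r)`, that function is a constant times the
generating function at the point `x/(1-r)` and parameter `v`; coefficients in `u` are then compared.
-/
theorem hasSum_choose_mul_pow_mul_laguerrePoly {a : ℝ} (ha : 0 ≤ a) (x : ℝ) {r : ℝ} (hr0 : 0 ≤ r)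
    (hr : r < 1) (j : ℕ) :
    HasSum (fun n => (n.choose j : ℝ) * (r ^ n * laguerrePoly a n x))
      ((1 - r) ^ (-(a + 1)) * Real.exp (-(x * r / (1 - r))) *
        ((r / (1 - r)) ^ j * laguerrePoly a j (x / (1 - r)))) := by
  have h1r : 0 < 1 - r := by linarith
  set F : ℝ → ℕ × ℕ → ℝ := fun u p =>
    r ^ p.1 * laguerrePoly a p.1 x * ((p.1.choose p.2 : ℝ) * u ^ p.2) with hF
  have binom : ∀ (u : ℝ) (n : ℕ), HasSum (fun j => (n.choose j : ℝ) * u ^ j) ((1 + u) ^ n) := by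
    intro u n
    have : (1 + u) ^ n = ∑ j ∈ Finset.range (n + 1), (n.choose j : ℝ) * u ^ j := by
      rw [add_comm, add_pow]
      exact Finset.sum_congr rfl fun j _ => by ring
    rw [this]
    refine hasSum_sum_of_ne_finset_zero fun j hj => ?_
    rw [Nat.choose_eq_zero_of_lt (by simpa using hj)]
    simp
  -- For `|u| < 1 - r` one has `r(1+|u|) ≤ r(2-r) = 1 - (1-r)² < 1`.
  have small : ∀ u, |u| < 1 - r → |r * (1 + |u|)| < 1 := by
    intro u hu
    rw [abs_of_nonneg (by positivity)]
    nlinarith [abs_nonneg u]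
  have hsum : ∀ u, |u| < 1 - r → Summable (F u) := by
    intro u hu
    have hnn : 0 ≤ fun p => ‖F u p‖ := fun p => norm_nonneg _
    refine Summable.of_norm ((summable_prod_of_nonneg hnn).2 ?_)
    have row : ∀ n, HasSum (fun j => ‖F u (n, j)‖)
        (|laguerrePoly a n x| * (r * (1 + |u|)) ^ n) := by
      intro n
      have h := (binom |u| n).mul_left (r ^ n * |laguerrePoly a n x|)
      rw [mul_pow, show ∀ p q s : ℝ, p * (q * s) = q * p * s from fun _ _ _ => by ring]
      refine h.congr_fun fun j => ?_
      simp only [hF, norm_mul, norm_pow, Real.norm_eq_abs, Nat.abs_cast, abs_of_nonneg hr0]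
    refine ⟨fun n => (row n).summable, ?_⟩
    simp only [fun n => (row n).tsum_eq]
    exact summable_abs_laguerrePoly_mul_pow ha x (by positivity)
      ((le_abs_self _).trans_lt (small u hu))
  have hcol : ∀ j, Summable fun n => (n.choose j : ℝ) * (r ^ n * laguerrePoly a n x) := by
    intro j
    -- Any admissible nonzero `u` would do: each column of the summable family at `u` is divided by
    -- `u^j`.
    have hu : |(1 - r) / 2| < 1 - r := by rw [abs_of_pos (by positivity)]; linarith
    have h := ((Equiv.prodComm ℕ ℕ).summable_iff.2 (hsum _ hu)).prod_factor j
    have h' := h.mul_right ((((1 - r) / 2) ^ j)⁻¹)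
    refine h'.congr fun n => ?_
    have : ((1 - r) / 2) ^ j ≠ 0 := by positivity
    simp only [hF, Function.comp, Equiv.prodComm_apply, Prod.swap_prod_mk]
    field_simp
  have key := eq_of_hasSum_mul_pow (ρ := 1 - r)
    (f := fun j => ∑' n, (n.choose j : ℝ) * (r ^ n * laguerrePoly a n x))
    (g := fun j => (1 - r) ^ (-(a + 1)) * Real.exp (-(x * r / (1 - r))) *
        ((r / (1 - r)) ^ j * laguerrePoly a j (x / (1 - r))))
    (F := fun u => (1 - r * (1 + u)) ^ (-(a + 1)) *
      Real.exp (-(x * (r * (1 + u)) / (1 - r * (1 + u))))) h1r ?_ ?_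
  · have := congrFun key j
    rw [← this]
    exact (hcol j).hasSum
  · intro u hu
    have hru : |r * (1 + u)| < 1 := by
      refine lt_of_le_of_lt ?_ ((le_abs_self _).trans_lt (small u hu))
      rw [abs_mul, abs_of_nonneg hr0]
      gcongr
      exact (abs_add_le _ _).trans (by simp)
    have hs := (hsum u hu).hasSum
    have e := (hs.prod_fiberwise fun n => (binom u n).mul_left
      (r ^ n * laguerrePoly a n x)).unique ((hasSum_laguerrePoly_mul_pow ha x hru).congr_fun
        fun n => by rw [mul_pow]; ring)
    rw [e] at hs
    refine ((Equiv.prodComm ℕ ℕ).hasSum_iff.2 hs).prod_fiberwise fun j => ?_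
    refine ((hcol j).hasSum.mul_right (u ^ j)).congr_fun fun n => ?_
    simp only [hF, Function.comp, Equiv.prodComm_apply, Prod.swap_prod_mk]
    ring
  · intro u hu
    have hv : |r * u / (1 - r)| < 1 := by
      rw [abs_div, abs_of_pos h1r, div_lt_one h1r, abs_mul, abs_of_nonneg hr0]
      nlinarith [abs_nonneg u]
    have h := (hasSum_laguerrePoly_mul_pow ha (x / (1 - r)) hv).mul_left
      ((1 - r) ^ (-(a + 1)) * Real.exp (-(x * r / (1 - r))))
    have h1v : 0 < 1 - r * u / (1 - r) := by linarith [(abs_lt.1 hv).2]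
    have e1 : 1 - r * (1 + u) = (1 - r) * (1 - r * u / (1 - r)) := by field_simp; ring
    have h2 : (1 : ℝ) - r * (1 + u) ≠ 0 := by rw [e1]; positivity
    have e2 : -(x * (r * (1 + u)) / (1 - r * (1 + u))) =
        -(x * r / (1 - r)) + -(x / (1 - r) * (r * u / (1 - r)) / (1 - r * u / (1 - r))) := by
      rw [show 1 - r * u / (1 - r) = (1 - r * (1 + u)) / (1 - r) by rw [e1]; field_simp]
      field_simp
      ring
    rw [e2, Real.exp_add, e1, Real.mul_rpow h1r.le h1v.le,
      show ∀ p q s t : ℝ, p * q * (s * t) = p * s * (q * t) from fun _ _ _ _ => by ring]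
    refine h.congr_fun fun n => ?_
    rw [show r * u / (1 - r) = r / (1 - r) * u by ring, mul_pow]
    ring

/-- The entire function `∑ i, z ^ i / (i! Γ(i + a + 1))`, related to the modified Bessel function
by `I_a(2 √z) = z ^ (a / 2) * besselSeries a z`. -/
noncomputable def besselSeries (a z : ℝ) : ℝ :=
  ∑' i : ℕ, z ^ i / Nat.factorial i / Real.Gamma (i + a + 1)

theorem summable_abs_besselSeries {a : ℝ} (ha : 0 ≤ a) (z : ℝ) :
    Summable fun i : ℕ => ‖z ^ i / Nat.factorial i / Real.Gamma (i + a + 1)‖ := by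
  have hg := Real.Gamma_pos_of_pos (show 0 < a + 1 by positivity)
  refine ((Real.summable_pow_div_factorial |z|).div_const (Real.Gamma (a + 1))).of_nonneg_of_le
    (fun i => norm_nonneg _) fun i => ?_
  have h1 := Gamma_natCast_add_pos ha i
  rw [norm_div, norm_div, norm_pow, Real.norm_of_nonneg h1.le, RCLike.norm_natCast,
    Real.norm_eq_abs]
  gcongr
  refine le_trans ?_ (factorial_mul_Gamma_le ha i)
  exact le_mul_of_one_le_left hg.le (by exact_mod_cast Nat.one_le_iff_ne_zero.2 i.factorial_ne_zero)

theorem hasSum_besselSeries {a : ℝ} (ha : 0 ≤ a) (z : ℝ) :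
    HasSum (fun i : ℕ => z ^ i / Nat.factorial i / Real.Gamma (i + a + 1)) (besselSeries a z) :=
  (summable_abs_besselSeries ha z).of_norm.hasSum

/-- This is the Cauchy product of the exponential series of `w` with the Bessel series at `-xw`. -/
theorem hasSum_pow_div_Gamma_mul_laguerrePoly {a : ℝ} (ha : 0 ≤ a) (x w : ℝ) :
    HasSum (fun j : ℕ => w ^ j / Real.Gamma (j + a + 1) * laguerrePoly a j x)
      (Real.exp w * besselSeries a (-x * w)) := by
  have h := hasSum_sum_range_mul_of_summable_norm (summable_abs_besselSeries ha (-x * w))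
    (f := fun i : ℕ => (-x * w) ^ i / Nat.factorial i / Real.Gamma (i + a + 1))
    (g := fun m : ℕ => w ^ m / Nat.factorial m) (Real.summable_pow_div_factorial w).norm
  rw [show (∑' m : ℕ, w ^ m / Nat.factorial m) = Real.exp w by
    rw [Real.exp_eq_exp_ℝ, NormedSpace.exp_eq_tsum_div], mul_comm (∑' n : ℕ, _)] at h
  refine h.congr_fun fun n => ?_
  rw [laguerrePoly, Finset.mul_sum]
  refine Finset.sum_congr rfl fun j hj => ?_
  obtain ⟨m, rfl⟩ : ∃ m, n = j + m := ⟨n - j, by have := Finset.mem_range.1 hj; omega⟩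
  have h1 := Gamma_natCast_add_pos ha j
  have h2 := Gamma_natCast_add_pos ha (j + m)
  rw [Nat.add_sub_cancel_left, mul_pow, neg_pow x, pow_add]
  field_simp

theorem factorial_div_Gamma_mul_laguerrePoly {a : ℝ} (ha : 0 ≤ a) (n : ℕ) (y : ℝ) :
    Nat.factorial n / Real.Gamma (n + a + 1) * laguerrePoly a n y =
      ∑ j ∈ Finset.range (n + 1), (n.choose j : ℝ) * ((-y) ^ j / Real.Gamma (j + a + 1)) := by
  rw [laguerrePoly, Finset.mul_sum]
  refine Finset.sum_congr rfl fun j hj => ?_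
  have h1 := Gamma_natCast_add_pos ha j
  have h2 := Gamma_natCast_add_pos ha n
  rw [Nat.cast_choose ℝ (show j ≤ n by have := Finset.mem_range.1 hj; omega), neg_pow y]
  have h3 : (Nat.factorial (n - j) : ℝ) ≠ 0 := by positivity
  field_simp

/-- Writing `r^n = √r^n √r^n`, the factor in `x` is summable and the factor in `y` is bounded, both
because `√r < 1`. -/
theorem summable_laguerrePoly_mul_laguerrePoly {a : ℝ} (ha : 0 ≤ a) (x y : ℝ) {r : ℝ}
    (hr0 : 0 ≤ r) (hr : r < 1) :
    Summable fun n => r ^ n * |laguerrePoly a n x| *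
      (Nat.factorial n / Real.Gamma (n + a + 1) * |laguerrePoly a n y|) := by
  have hq0 := Real.sqrt_nonneg r
  have hq : Real.sqrt r < 1 := by rw [Real.sqrt_lt' one_pos]; simpa
  have hx := summable_abs_laguerrePoly_mul_pow ha x hq0 hq
  have hy := summable_abs_laguerrePoly_mul_pow ha y hq0 hq
  have hg := Real.Gamma_pos_of_pos (show 0 < a + 1 by positivity)
  obtain ⟨C, hC⟩ : ∃ C, ∀ n, |laguerrePoly a n y| * Real.sqrt r ^ n ≤ C := by
    obtain ⟨C, hC⟩ := hy.tendsto_atTop_zero.bddAbove_range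
    exact ⟨C, fun n => hC ⟨n, rfl⟩⟩
  refine (hx.mul_right (C / Real.Gamma (a + 1))).of_nonneg_of_le (fun n => ?_) fun n => ?_
  · have := Gamma_natCast_add_pos ha n
    positivity
  · have h1 := Gamma_natCast_add_pos ha n
    have h2 : Nat.factorial n / Real.Gamma (n + a + 1) ≤ 1 / Real.Gamma (a + 1) := by
      rw [div_le_div_iff₀ h1 hg, one_mul]
      exact factorial_mul_Gamma_le ha n
    have e : r ^ n = Real.sqrt r ^ n * Real.sqrt r ^ n := by
      rw [← mul_pow, Real.mul_self_sqrt hr0]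
    calc r ^ n * |laguerrePoly a n x| *
          (Nat.factorial n / Real.Gamma (n + a + 1) * |laguerrePoly a n y|)
        = |laguerrePoly a n x| * Real.sqrt r ^ n * ((|laguerrePoly a n y| * Real.sqrt r ^ n) *
          (Nat.factorial n / Real.Gamma (n + a + 1))) := by rw [e]; ring
      _ ≤ |laguerrePoly a n x| * Real.sqrt r ^ n * (C * (1 / Real.Gamma (a + 1))) := by
          gcongr
          · exact le_trans (by positivity) (hC n)
          · exact hC n
      _ = _ := by ring

/-- The normalised polynomial in `y` is expanded in binomials times `(-y)^j/Γ(j+a+1)`. Summing over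
`n` first leaves Laguerre polynomials at `x/(1-r)` divided by `Γ(j+a+1)`, whose sum over `j` is a
Bessel series. -/
theorem hasSum_laguerrePoly_mul_laguerrePoly {a : ℝ} (ha : 0 ≤ a) (x y : ℝ) {r : ℝ}
    (hr0 : 0 ≤ r) (hr : r < 1) :
    HasSum (fun n => r ^ n * laguerrePoly a n x *
      (Nat.factorial n / Real.Gamma (n + a + 1) * laguerrePoly a n y))
      ((1 - r) ^ (-(a + 1)) * Real.exp (-(x * r / (1 - r))) * Real.exp (-(y * r / (1 - r))) *
        besselSeries a (x * y * r / (1 - r) ^ 2)) := by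
  have h1r : 0 < 1 - r := by linarith
  set F : ℕ × ℕ → ℝ := fun p => r ^ p.1 * laguerrePoly a p.1 x *
    ((p.1.choose p.2 : ℝ) * ((-y) ^ p.2 / Real.Gamma (p.2 + a + 1))) with hF
  have row : ∀ (z : ℝ) (n : ℕ),
      HasSum (fun j : ℕ => (n.choose j : ℝ) * ((-z) ^ j / Real.Gamma (j + a + 1)))
      (Nat.factorial n / Real.Gamma (n + a + 1) * laguerrePoly a n z) := by
    intro z n
    rw [factorial_div_Gamma_mul_laguerrePoly ha]
    refine hasSum_sum_of_ne_finset_zero fun j hj => ?_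
    rw [Nat.choose_eq_zero_of_lt (by simpa using hj)]
    simp
  have hsum : Summable F := by
    have hnn : 0 ≤ fun p => ‖F p‖ := fun p => norm_nonneg _
    refine Summable.of_norm ((summable_prod_of_nonneg hnn).2 ?_)
    have row' : ∀ n, HasSum (fun j => ‖F (n, j)‖) (r ^ n * |laguerrePoly a n x| *
        (Nat.factorial n / Real.Gamma (n + a + 1) * laguerrePoly a n (-|y|))) := by
      intro n
      refine ((row (-|y|) n).mul_left (r ^ n * |laguerrePoly a n x|)).congr_fun fun j => ?_
      have h1 := Gamma_natCast_add_pos ha j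
      simp only [hF, norm_mul, norm_div, norm_pow, Real.norm_eq_abs, Nat.abs_cast, abs_neg, neg_neg,
        abs_of_nonneg hr0, abs_of_pos h1]
    refine ⟨fun n => (row' n).summable, ?_⟩
    simp only [fun n => (row' n).tsum_eq]
    refine (summable_laguerrePoly_mul_laguerrePoly ha x (-|y|) hr0 hr).congr fun n => ?_
    congr 2
    exact abs_of_nonneg ((abs_nonneg _).trans (abs_laguerrePoly_le ha n y))
  have hrow := hsum.hasSum.prod_fiberwise fun n => (row y n).mul_left (r ^ n * laguerrePoly a n x)
  have hcol := ((Equiv.prodComm ℕ ℕ).hasSum_iff.2 hsum.hasSum).prod_fiberwise fun j =>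
    ((hasSum_choose_mul_pow_mul_laguerrePoly ha x hr0 hr j).mul_right
      ((-y) ^ j / Real.Gamma (j + a + 1))).congr_fun fun n => by
        simp only [hF, Function.comp, Equiv.prodComm_apply, Prod.swap_prod_mk]
        ring
  have hbes := (hasSum_pow_div_Gamma_mul_laguerrePoly ha (x / (1 - r)) (-(y * r / (1 - r)))).mul_left
    ((1 - r) ^ (-(a + 1)) * Real.exp (-(x * r / (1 - r))))
  have e := hcol.unique (hbes.congr_fun fun j => by
    rw [show -(y * r / (1 - r)) = (-y) * (r / (1 - r)) by ring, mul_pow]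
    ring)
  rw [e] at hrow
  rwa [← mul_assoc, show -(x / (1 - r)) * -(y * r / (1 - r)) = x * y * r / (1 - r) ^ 2 by
    field_simp] at hrow

/-! ### Estimates for the one-dimensional heat kernel -/

/-- Integration by parts gives the recurrence of the lower incomplete Gamma function. -/
theorem intervalIntegral_rpow_mul_exp_neg_add_one {s z : ℝ} (hs : 0 < s) (hz : 0 ≤ z) :
    ∫ u in (0 : ℝ)..z, Real.exp (-u) * u ^ (s + 1 - 1) =
      s * (∫ u in (0 : ℝ)..z, Real.exp (-u) * u ^ (s - 1)) - z ^ s * Real.exp (-z) := by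
  have hint : ∀ s : ℝ, 0 < s →
      IntervalIntegrable (fun u : ℝ => Real.exp (-u) * u ^ (s - 1)) volume 0 z := by
    intro s hs
    rw [intervalIntegrable_iff_integrableOn_Ioc_of_le hz]
    exact (Real.GammaIntegral_convergent hs).mono_set Set.Ioc_subset_Ioi_self
  have h := intervalIntegral.integral_eq_sub_of_hasDerivAt_of_le hz
    (f := fun u : ℝ => u ^ s * Real.exp (-u))
    (f' := fun u : ℝ => s * (Real.exp (-u) * u ^ (s - 1)) - Real.exp (-u) * u ^ (s + 1 - 1))
    (by
      refine ContinuousOn.mul (fun u _ => ?_) (by fun_prop)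
      exact (Real.continuousAt_rpow_const u s (Or.inr hs.le)).continuousWithinAt)
    (fun u hu => by
      have h1 : HasDerivAt (fun v : ℝ => v ^ s) (s * u ^ (s - 1)) u :=
        Real.hasDerivAt_rpow_const (Or.inl hu.1.ne')
      have h2 : HasDerivAt (fun v : ℝ => Real.exp (-v)) (Real.exp (-u) * -1) u :=
        (hasDerivAt_neg u).exp
      refine (h1.mul h2).congr_deriv ?_
      rw [add_sub_cancel_right]
      ring)
    (((hint s hs).const_mul s).sub (hint (s + 1) (by positivity)))
  rw [intervalIntegral.integral_sub ((hint s hs).const_mul s) (hint (s + 1) (by positivity)),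
    intervalIntegral.integral_const_mul, Real.zero_rpow hs.ne'] at h
  linarith

/-- The quotient `P m` of the lower incomplete Gamma function at `m + b` by `Γ(m+b)` lies between
`0` and `1`, and each term equals `e^z (P m - P (m+1))`, so the sum telescopes. The case `b = 0` is
separate because the integral in `P 0` then diverges; there the sum is a partial exponential series.
-/
theorem sum_rpow_div_Gamma_le_exp {b z : ℝ} (hb : 0 ≤ b) (hz : 0 ≤ z) (N : ℕ) :
    ∑ m ∈ Finset.range N, z ^ (m + b) / Real.Gamma (m + b + 1) ≤ Real.exp z := by
  rcases hb.eq_or_lt with rfl | hb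
  · have h := Real.sum_le_exp_of_nonneg hz N
    simpa [Real.Gamma_nat_eq_factorial] using h
  set P : ℕ → ℝ := fun m => (∫ u in (0 : ℝ)..z, Real.exp (-u) * u ^ ((m + b) - 1)) /
    Real.Gamma (m + b) with hP
  have hg : ∀ m : ℕ, 0 < Real.Gamma (m + b) := fun m => Real.Gamma_pos_of_pos (by positivity)
  have step : ∀ m : ℕ, z ^ (m + b) / Real.Gamma (m + b + 1) =
      Real.exp z * (P m - P (m + 1)) := by
    intro m
    have hs : 0 < (m : ℝ) + b := by positivity
    have h := intervalIntegral_rpow_mul_exp_neg_add_one hs hz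
    have h1 := hg m
    simp only [hP]
    rw [show ((m + 1 : ℕ) : ℝ) + b = m + b + 1 by push_cast; ring, h, Real.Gamma_add_one hs.ne',
      Real.exp_neg]
    have := Real.exp_pos z
    field_simp
    ring
  rw [Finset.sum_congr rfl fun m _ => step m, ← Finset.mul_sum, Finset.sum_range_sub']
  have hN : 0 ≤ P N := by
    refine div_nonneg (intervalIntegral.integral_nonneg hz fun u hu => ?_) (hg N).le
    have := hu.1
    positivity
  have h0 : P 0 ≤ 1 := by
    rw [div_le_one (hg 0), Real.Gamma_eq_integral (by positivity),
      intervalIntegral.integral_of_le hz]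
    refine setIntegral_mono_set (Real.GammaIntegral_convergent (by positivity)) ?_
      Set.Ioc_subset_Ioi_self.eventuallyLE
    refine (ae_restrict_iff' measurableSet_Ioi).2 (Eventually.of_forall fun u hu => ?_)
    have : (0 : ℝ) < u := hu
    simp only [Pi.zero_apply]
    positivity
  nlinarith [Real.exp_pos z]

/-- Log-convexity of `Γ` at the midpoint of `m+1` and `m+2b+1`. -/
theorem Gamma_sq_le {b : ℝ} (hb : 0 ≤ b) (m : ℕ) :
    Real.Gamma (m + b + 1) ^ 2 ≤ Nat.factorial m * Real.Gamma (m + 2 * b + 1) := by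
  have h := Real.Gamma_mul_add_mul_le_rpow_Gamma_mul_rpow_Gamma (s := m + 1) (t := m + 2 * b + 1)
    (a := 1 / 2) (b := 1 / 2) (by positivity) (by positivity) (by norm_num) (by norm_num)
    (by norm_num)
  have h1 : 0 ≤ Real.Gamma ((m : ℝ) + 1) := (Real.Gamma_pos_of_pos (by positivity)).le
  have h2 : 0 ≤ Real.Gamma ((m : ℝ) + 2 * b + 1) := (Real.Gamma_pos_of_pos (by positivity)).le
  have h3 : 0 ≤ Real.Gamma ((m : ℝ) + b + 1) := (Real.Gamma_pos_of_pos (by positivity)).le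
  rw [← Real.sqrt_eq_rpow, ← Real.sqrt_eq_rpow,
    show 1 / 2 * ((m : ℝ) + 1) + 1 / 2 * (m + 2 * b + 1) = m + b + 1 by ring] at h
  calc Real.Gamma (m + b + 1) ^ 2
      ≤ (Real.sqrt (Real.Gamma (m + 1)) * Real.sqrt (Real.Gamma (m + 2 * b + 1))) ^ 2 := by gcongr
    _ = _ := by
      rw [mul_pow, Real.sq_sqrt h1, Real.sq_sqrt h2, Real.Gamma_nat_eq_factorial]

/-- In Bessel terms this is `I_a(2z) ≤ e^(2z)`. By `Gamma_sq_le` each term is at most the square of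
a term of the series bounded by `e^z`, and a sum of squares of nonnegative numbers is at most the
square of their sum. -/
theorem rpow_mul_besselSeries_le {a z : ℝ} (ha : 0 ≤ a) (hz : 0 < z) :
    (z ^ 2) ^ (a / 2) * besselSeries a (z ^ 2) ≤ Real.exp (2 * z) := by
  have hs := (hasSum_besselSeries ha (z ^ 2)).mul_left ((z ^ 2) ^ (a / 2))
  rw [← hs.tsum_eq]
  have hb : 0 ≤ a / 2 := by positivity
  have hg : ∀ m : ℕ, 0 < Real.Gamma (m + a / 2 + 1) := Gamma_natCast_add_pos hb
  refine Real.tsum_le_of_sum_range_le (fun m => ?_) fun N => ?_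
  · have := Gamma_natCast_add_pos ha m
    positivity
  have hterm : ∀ m : ℕ, (z ^ 2) ^ (a / 2) *
      ((z ^ 2) ^ m / Nat.factorial m / Real.Gamma (m + a + 1)) ≤
      (z ^ (m + a / 2) / Real.Gamma (m + a / 2 + 1)) ^ 2 := by
    intro m
    have h1 := hg m
    have h := Gamma_sq_le hb m
    rw [mul_div_cancel₀ a two_ne_zero] at h
    rw [div_pow, div_div, ← mul_div_assoc, Real.rpow_add hz, Real.rpow_natCast, mul_pow,
      ← pow_mul, ← pow_mul, mul_comm 2 m, ← Real.rpow_natCast z 2, ← Real.rpow_mul hz.le,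
      ← Real.rpow_natCast (z ^ (a / 2)) 2, ← Real.rpow_mul hz.le, mul_comm (a / 2),
      mul_comm (z ^ (m * 2))]
    gcongr
  have hnn : ∀ m : ℕ, 0 ≤ z ^ (m + a / 2) / Real.Gamma (m + a / 2 + 1) := by
    intro m
    have h1 := hg m
    positivity
  calc _ ≤ ∑ m ∈ Finset.range N, (z ^ (m + a / 2) / Real.Gamma (m + a / 2 + 1)) ^ 2 :=
        Finset.sum_le_sum fun m _ => hterm m
    _ ≤ (∑ m ∈ Finset.range N, z ^ (m + a / 2) / Real.Gamma (m + a / 2 + 1)) ^ 2 :=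
        Finset.sum_sq_le_sq_sum_of_nonneg fun m _ => hnn m
    _ ≤ Real.exp z ^ 2 := by
        have := sum_rpow_div_Gamma_le_exp hb hz.le N
        have := Finset.sum_nonneg fun m (_ : m ∈ Finset.range N) => hnn m
        gcongr
    _ = Real.exp (2 * z) := by rw [← Real.exp_nat_mul]; norm_num

/-- The one-dimensional Laguerre heat kernel, in the closed form given by the Hille–Hardy
formula. -/
noncomputable def laguerreHeat (a t x y : ℝ) : ℝ :=
  (2 * Real.sinh (t / 2))⁻¹ *
    (((2 * Real.sinh (t / 2))⁻¹ ^ 2 * (x * y)) ^ (a / 2) *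
      besselSeries a ((2 * Real.sinh (t / 2))⁻¹ ^ 2 * (x * y))) *
    Real.exp (-(Real.cosh (t / 2) / Real.sinh (t / 2)) * (x + y) / 2)

theorem exp_mul_laguerreFun1_mul_laguerreFun1 {a : ℝ} (ha : 0 ≤ a) (t : ℝ) {x y : ℝ} (hx : 0 < x)
    (hy : 0 < y) (k : ℕ) :
    Real.exp (-t * (k + (a + 1) / 2)) * laguerreFun1 a k x * laguerreFun1 a k y =
      Real.exp (-t * ((a + 1) / 2)) * ((x * y) ^ (a / 2) * Real.exp (-(x + y) / 2)) *
      (Real.exp (-t) ^ k * laguerrePoly a k x *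
        (Nat.factorial k / Real.Gamma (k + a + 1) * laguerrePoly a k y)) := by
  have h1 := Gamma_natCast_add_pos ha k
  have e1 : Real.exp (-t * (k + (a + 1) / 2)) = Real.exp (-t) ^ k * Real.exp (-t * ((a + 1) / 2)) := by
    rw [← Real.exp_nat_mul, ← Real.exp_add]
    ring_nf
  have e2 : Real.exp (-(x + y) / 2) = Real.exp (-x / 2) * Real.exp (-y / 2) := by
    rw [← Real.exp_add]
    ring_nf
  have e3 : Nat.factorial k / Real.Gamma (k + a + 1) =
      Real.sqrt (Real.Gamma (k + 1) / Real.Gamma (k + a + 1)) *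
        Real.sqrt (Real.Gamma (k + 1) / Real.Gamma (k + a + 1)) := by
    rw [Real.Gamma_nat_eq_factorial, Real.mul_self_sqrt (by positivity)]
  rw [e1, e2, e3, Real.mul_rpow hx.le hy.le]
  simp only [laguerreFun1]
  ring

theorem hasSum_laguerreHeat {a : ℝ} (ha : 0 ≤ a) {t : ℝ} (ht : 0 < t) {x y : ℝ}
    (hx : 0 < x) (hy : 0 < y) :
    HasSum (fun k : ℕ =>
      Real.exp (-t * (k + (a + 1) / 2)) * laguerreFun1 a k x * laguerreFun1 a k y)
      (laguerreHeat a t x y) := by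
  have hlt : Real.exp (-t) < 1 := Real.exp_lt_one_iff.2 (by linarith)
  have h := (hasSum_laguerrePoly_mul_laguerrePoly ha x y (Real.exp_pos (-t)).le hlt).mul_left
    (Real.exp (-t * ((a + 1) / 2)) * ((x * y) ^ (a / 2) * Real.exp (-(x + y) / 2)))
  simp only [← exp_mul_laguerreFun1_mul_laguerreFun1 ha t hx hy] at h
  suffices e : laguerreHeat a t x y = Real.exp (-t * ((a + 1) / 2)) *
      ((x * y) ^ (a / 2) * Real.exp (-(x + y) / 2)) *
      ((1 - Real.exp (-t)) ^ (-(a + 1)) * Real.exp (-(x * Real.exp (-t) / (1 - Real.exp (-t)))) *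
        Real.exp (-(y * Real.exp (-t) / (1 - Real.exp (-t)))) *
        besselSeries a (x * y * Real.exp (-t) / (1 - Real.exp (-t)) ^ 2)) by rw [e]; exact h
  have hs : 0 < Real.sinh (t / 2) := Real.sinh_pos_iff.2 (by positivity)
  -- In this variable `r = q²`, `(2 sinh (t/2))⁻¹ = q/(1-q²)` and `coth (t/2) = (1+q²)/(1-q²)`, so
  -- everything is rational in `q` apart from real powers and exponentials.
  set q := Real.exp (-(t / 2)) with hq
  have hq0 : 0 < q := Real.exp_pos _
  have hr : Real.exp (-t) = q ^ 2 := by rw [hq, ← Real.exp_nat_mul]; ring_nf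
  have hqi : Real.exp (t / 2) = q⁻¹ := by rw [hq, ← Real.exp_neg, neg_neg]
  have hsinh : Real.sinh (t / 2) = (1 - q ^ 2) / (2 * q) := by
    rw [Real.sinh_eq, ← hq, hqi]; field_simp
  have hcosh : Real.cosh (t / 2) = (1 + q ^ 2) / (2 * q) := by
    rw [Real.cosh_eq, ← hq, hqi]; field_simp
  have h1q : 0 < 1 - q ^ 2 := by rw [← hr]; linarith
  have hw : (2 * Real.sinh (t / 2))⁻¹ = q / (1 - q ^ 2) := by
    rw [hsinh]; field_simp
  have hc : Real.cosh (t / 2) / Real.sinh (t / 2) = (1 + q ^ 2) / (1 - q ^ 2) := by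
    rw [hsinh, hcosh]; field_simp
  have hqa : Real.exp (-t * ((a + 1) / 2)) = q ^ (a + 1) := by
    rw [hq, ← Real.exp_mul]; ring_nf
  have harg : (q / (1 - q ^ 2)) ^ 2 * (x * y) = x * y * q ^ 2 / (1 - q ^ 2) ^ 2 := by
    field_simp
  rw [laguerreHeat, hw, hc, hqa, hr, harg]
  have hexp : Real.exp (-((1 + q ^ 2) / (1 - q ^ 2)) * (x + y) / 2) =
      Real.exp (-(x + y) / 2) * (Real.exp (-(x * q ^ 2 / (1 - q ^ 2))) *
        Real.exp (-(y * q ^ 2 / (1 - q ^ 2)))) := by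
    rw [← Real.exp_add, ← Real.exp_add]
    congr 1
    field_simp
    ring
  have hpow : q / (1 - q ^ 2) * (x * y * q ^ 2 / (1 - q ^ 2) ^ 2) ^ (a / 2) =
      q ^ (a + 1) * (x * y) ^ (a / 2) * (1 - q ^ 2) ^ (-(a + 1)) := by
    have hxy : 0 < x * y := by positivity
    rw [show x * y * q ^ 2 / (1 - q ^ 2) ^ 2 = (x * y) * (q / (1 - q ^ 2)) ^ 2 by
      field_simp, Real.mul_rpow hxy.le (by positivity), ← Real.rpow_natCast_mul (by positivity),
      show ((2 : ℕ) : ℝ) * (a / 2) = a by push_cast; ring,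
      Real.rpow_neg h1q.le, show ∀ u v w : ℝ, u * v * w⁻¹ = v * (u / w) from
        fun _ _ _ => by ring, ← Real.div_rpow hq0.le h1q.le, Real.rpow_add_one (by positivity)]
    ring
  rw [hexp, ← mul_assoc (q / (1 - q ^ 2)), hpow]
  ring

theorem laguerreHeat_comm (a t x y : ℝ) : laguerreHeat a t x y = laguerreHeat a t y x := by
  simp only [laguerreHeat, mul_comm x y, add_comm x y]

theorem besselSeries_nonneg {a z : ℝ} (ha : 0 ≤ a) (hz : 0 ≤ z) : 0 ≤ besselSeries a z := by
  refine tsum_nonneg fun i => ?_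
  have := Gamma_natCast_add_pos ha i
  positivity

theorem laguerreHeat_nonneg {a : ℝ} (ha : 0 ≤ a) {t : ℝ} (ht : 0 < t) {x y : ℝ}
    (hx : 0 < x) (hy : 0 < y) : 0 ≤ laguerreHeat a t x y := by
  have hs : 0 < Real.sinh (t / 2) := Real.sinh_pos_iff.2 (by positivity)
  have := besselSeries_nonneg ha
    (show 0 ≤ (2 * Real.sinh (t / 2))⁻¹ ^ 2 * (x * y) by positivity)
  unfold laguerreHeat
  positivity

/-- After the Bessel bound the exponent is `(√(xy) - cosh (t/2) (x+y)/2) / sinh (t/2)`, which is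
nonpositive by the arithmetic-geometric mean inequality and `cosh ≥ 1`. -/
theorem laguerreHeat_le {a : ℝ} (ha : 0 ≤ a) {t : ℝ} (ht : 0 < t) {x y : ℝ}
    (hx : 0 < x) (hy : 0 < y) : laguerreHeat a t x y ≤ (2 * Real.sinh (t / 2))⁻¹ := by
  have hs : 0 < Real.sinh (t / 2) := Real.sinh_pos_iff.2 (by positivity)
  have hc : 1 ≤ Real.cosh (t / 2) := Real.one_le_cosh _
  have hz : 0 < (2 * Real.sinh (t / 2))⁻¹ * Real.sqrt (x * y) := by positivity
  have h := rpow_mul_besselSeries_le ha hz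
  rw [mul_pow, Real.sq_sqrt (by positivity)] at h
  unfold laguerreHeat
  rw [mul_assoc]
  refine mul_le_of_le_one_right (by positivity) ?_
  refine (mul_le_mul_of_nonneg_right h (Real.exp_pos _).le).trans ?_
  rw [← Real.exp_add, Real.exp_le_one_iff]
  have hamgm : Real.sqrt (x * y) ≤ (x + y) / 2 := by
    rw [Real.sqrt_le_left (by positivity)]
    nlinarith [sq_nonneg (x - y)]
  have e : 2 * ((2 * Real.sinh (t / 2))⁻¹ * Real.sqrt (x * y)) +
      -(Real.cosh (t / 2) / Real.sinh (t / 2)) * (x + y) / 2 =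
      (Real.sqrt (x * y) - Real.cosh (t / 2) * ((x + y) / 2)) / Real.sinh (t / 2) := by
    field_simp
    ring
  rw [e]
  refine div_nonpos_of_nonpos_of_nonneg ?_ hs.le
  nlinarith

theorem lintegral_rpow_mul_exp_neg_mul {s c : ℝ} (hs : 0 < s) (hc : 0 < c) :
    ∫⁻ y in Set.Ioi (0 : ℝ), ENNReal.ofReal (y ^ (s - 1) * Real.exp (-(c * y))) =
      ENNReal.ofReal ((1 / c) ^ s * Real.Gamma s) := by
  rw [← Real.integral_rpow_mul_exp_neg_mul_Ioi hs hc, ofReal_integral_eq_lintegral_ofReal]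
  · have hpos : 0 < (1 / c) ^ s * Real.Gamma s := by
      have := Real.Gamma_pos_of_pos hs
      positivity
    -- Integrability comes for free: the Bochner integral of a nonintegrable function is `0`,
    -- whereas the value here is positive.
    by_contra hni
    rw [← Real.integral_rpow_mul_exp_neg_mul_Ioi hs hc, integral_undef hni] at hpos
    exact hpos.false
  · refine (ae_restrict_iff' measurableSet_Ioi).2 (Eventually.of_forall fun u hu => ?_)
    have : (0 : ℝ) < u := hu
    simp only [Pi.zero_apply]
    positivity

theorem lintegral_laguerreHeat_le {a : ℝ} (ha : 0 ≤ a) {t : ℝ} (ht : 0 < t) {x : ℝ}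
    (hx : 0 < x) :
    ∫⁻ y in Set.Ioi (0 : ℝ), ENNReal.ofReal (laguerreHeat a t x y) ≤
      ENNReal.ofReal (Real.cosh (t / 2))⁻¹ := by
  have hs : 0 < Real.sinh (t / 2) := Real.sinh_pos_iff.2 (by positivity)
  have hch : 1 ≤ Real.cosh (t / 2) := Real.one_le_cosh _
  have hcs := Real.cosh_sq (t / 2)
  set S := Real.sinh (t / 2) with hS
  set C := Real.cosh (t / 2) with hC
  set b := a / 2 with hb
  have hb0 : 0 ≤ b := by positivity
  have hC0 : 0 < C := by linarith
  set T : ℕ → ℝ → ℝ := fun m y => (2 * S)⁻¹ * Real.exp (-(C / S * x / 2)) *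
    ((2 * S)⁻¹ ^ 2 * x) ^ (m + b) / Nat.factorial m / Real.Gamma (m + a + 1) *
    (y ^ ((m + b + 1) - 1) * Real.exp (-(C / (2 * S) * y))) with hT
  have hTnn : ∀ m y, 0 < y → 0 ≤ T m y := by
    intro m y hy
    have := Gamma_natCast_add_pos ha m
    simp only [hT]
    positivity
  have hTsum : ∀ y, 0 < y → HasSum (fun m => T m y) (laguerreHeat a t x y) := by
    intro y hy
    have h := ((hasSum_besselSeries ha ((2 * S)⁻¹ ^ 2 * (x * y))).mul_left
      ((2 * S)⁻¹ * ((2 * S)⁻¹ ^ 2 * (x * y)) ^ b)).mul_right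
      (Real.exp (-(C / S) * (x + y) / 2))
    rw [laguerreHeat, ← hS, ← hC, ← hb, ← mul_assoc]
    refine h.congr_fun fun m => ?_
    have e1 : Real.exp (-(C / S) * (x + y) / 2) =
        Real.exp (-(C / S * x / 2)) * Real.exp (-(C / (2 * S) * y)) := by
      rw [← Real.exp_add]
      congr 1
      field_simp
      ring
    have hz : 0 < (2 * S)⁻¹ ^ 2 * x := by positivity
    rw [e1, ← mul_assoc _ x y, Real.mul_rpow hz.le hy.le, mul_pow ((2 * S)⁻¹ ^ 2 * x) y]
    simp only [hT]
    rw [add_sub_cancel_right, Real.rpow_add hz, Real.rpow_add hy, Real.rpow_natCast,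
      Real.rpow_natCast]
    ring
  have hTmeas : ∀ m, Measurable (T m) := by
    intro m
    simp only [hT]
    fun_prop
  -- Integrating `y^(m+b) exp (-(C/(2S)) y)` multiplies `(x/(2S)²)^(m+b)` by `(2S/C)^(m+b+1)`. The
  -- base becomes this `z`, and the extra factor `2S/C` turns the prefactor `(2S)⁻¹` into `C⁻¹`.
  set z := x / (2 * S * C) with hz
  have hz0 : 0 < z := by positivity
  have hTint : ∀ m, ∫⁻ y in Set.Ioi (0 : ℝ), ENNReal.ofReal (T m y) ≤
      ENNReal.ofReal (C⁻¹ * Real.exp (-(C / S * x / 2)) *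
        (z ^ (m + b) / Real.Gamma (m + b + 1))) := by
    intro m
    have h1 := Gamma_natCast_add_pos ha m
    have h2 := Gamma_natCast_add_pos hb0 m
    have hK : 0 ≤ (2 * S)⁻¹ * Real.exp (-(C / S * x / 2)) *
        ((2 * S)⁻¹ ^ 2 * x) ^ (m + b) / Nat.factorial m / Real.Gamma (m + a + 1) := by positivity
    simp only [hT, ENNReal.ofReal_mul hK]
    rw [lintegral_const_mul _ (by fun_prop), lintegral_rpow_mul_exp_neg_mul (by positivity)
      (by positivity), ← ENNReal.ofReal_mul hK]
    refine ENNReal.ofReal_le_ofReal ?_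
    have hsq := Gamma_sq_le hb0 m
    rw [hb, mul_div_cancel₀ a two_ne_zero, ← hb] at hsq
    have hzz : z ^ (m + b) = ((2 * S)⁻¹ ^ 2 * x) ^ (m + b) * (1 / (C / (2 * S))) ^ (m + b) := by
      rw [← Real.mul_rpow (by positivity) (by positivity)]
      congr 1
      rw [hz]
      field_simp
    have h3 : Real.Gamma (m + b + 1) / (Nat.factorial m * Real.Gamma (m + a + 1)) ≤
        1 / Real.Gamma (m + b + 1) := by
      rw [div_le_div_iff₀ (by positivity) h2, ← sq, one_mul]
      exact hsq
    rw [Real.rpow_add_one (by positivity)]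
    calc _ = C⁻¹ * Real.exp (-(C / S * x / 2)) * (z ^ (m + b) *
          (Real.Gamma (m + b + 1) / (Nat.factorial m * Real.Gamma (m + a + 1)))) := by
          rw [hzz]
          field_simp
      _ ≤ C⁻¹ * Real.exp (-(C / S * x / 2)) * (z ^ (m + b) * (1 / Real.Gamma (m + b + 1))) := by
          gcongr
      _ = _ := by ring
  calc ∫⁻ y in Set.Ioi (0 : ℝ), ENNReal.ofReal (laguerreHeat a t x y)
      = ∫⁻ y in Set.Ioi (0 : ℝ), ∑' m, ENNReal.ofReal (T m y) := by
        refine setLIntegral_congr_fun measurableSet_Ioi fun y hy => ?_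
        rw [← (hTsum y hy).tsum_eq, ENNReal.ofReal_tsum_of_nonneg (fun m => hTnn m y hy)
          (hTsum y hy).summable]
    _ = ∑' m, ∫⁻ y in Set.Ioi (0 : ℝ), ENNReal.ofReal (T m y) :=
        lintegral_tsum fun m => (hTmeas m).ennreal_ofReal.aemeasurable
    _ ≤ ∑' m : ℕ, ENNReal.ofReal (C⁻¹ * Real.exp (-(C / S * x / 2)) *
        (z ^ (m + b) / Real.Gamma (m + b + 1))) := ENNReal.tsum_le_tsum hTint
    _ ≤ ENNReal.ofReal C⁻¹ := by
        refine ENNReal.tsum_le_of_sum_range_le fun N => ?_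
        rw [← ENNReal.ofReal_sum_of_nonneg fun m _ => ?_]
        · refine ENNReal.ofReal_le_ofReal ?_
          rw [← Finset.mul_sum, mul_assoc]
          refine mul_le_of_le_one_right (by positivity) ?_
          refine (mul_le_mul_of_nonneg_left (sum_rpow_div_Gamma_le_exp hb0 hz0.le N)
            (Real.exp_pos _).le).trans ?_
          rw [← Real.exp_add, Real.exp_le_one_iff]
          have : -(C / S * x / 2) + z = x / (2 * S * C) * (1 - C ^ 2) := by
            rw [hz]
            field_simp
            ring
          rw [this]
          refine mul_nonpos_of_nonneg_of_nonpos (by positivity) ?_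
          nlinarith
        · have := Gamma_natCast_add_pos hb0 m
          positivity

theorem measurable_besselSeries {a : ℝ} (ha : 0 ≤ a) : Measurable (besselSeries a) := by
  refine measurable_of_tendsto_metrizable (f := fun N z => ∑ i ∈ Finset.range N,
    z ^ i / Nat.factorial i / Real.Gamma (i + a + 1)) (fun N => by fun_prop) ?_
  exact tendsto_pi_nhds.2 fun z => (hasSum_besselSeries ha z).tendsto_sum_nat

theorem measurable_laguerreHeat {a : ℝ} (ha : 0 ≤ a) (t : ℝ) :
    Measurable fun p : ℝ × ℝ => laguerreHeat a t p.1 p.2 := by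
  have := measurable_besselSeries ha
  unfold laguerreHeat
  fun_prop

/-! ### The Laguerre functions and the heat kernel in several variables -/

theorem orthant_eq_pi (d : ℕ) : orthant d = Set.univ.pi fun _ => Set.Ioi (0 : ℝ) := by
  ext x
  simp [orthant]

theorem measurableSet_orthant (d : ℕ) : MeasurableSet (orthant d) := by
  rw [orthant_eq_pi]
  exact MeasurableSet.univ_pi fun _ => measurableSet_Ioi

theorem orthantMeasure_eq_pi (d : ℕ) :
    orthantMeasure d = Measure.pi fun _ => volume.restrict (Set.Ioi (0 : ℝ)) := by
  rw [orthantMeasure, orthant_eq_pi, volume_pi, Measure.restrict_pi_pi]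

instance (d : ℕ) : SigmaFinite (orthantMeasure d) := by
  unfold orthantMeasure
  infer_instance

theorem ae_mem_orthant (d : ℕ) : ∀ᵐ x ∂orthantMeasure d, x ∈ orthant d :=
  ae_restrict_mem (measurableSet_orthant d)

theorem hasSum_mul_prod {ι κ : Type*} {f : ι → ℝ} {g : κ → ℝ} {s t : ℝ} (hf : HasSum f s)
    (hg : HasSum g t) : HasSum (fun p : ι × κ => f p.1 * g p.2) (s * t) :=
  hf.mul hg (summable_mul_of_summable_norm hf.summable.norm hg.summable.norm)

theorem hasSum_prod_pi {d : ℕ} {f : Fin d → ℕ → ℝ} {s : Fin d → ℝ}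
    (h : ∀ i, HasSum (f i) (s i)) :
    HasSum (fun k : Fin d → ℕ => ∏ i, f i (k i)) (∏ i, s i) := by
  induction d with
  | zero =>
    simp only [Finset.univ_eq_empty, Finset.prod_empty]
    exact hasSum_unique _
  | succ d ih =>
    have hm := hasSum_mul_prod (h 0) (ih (f := fun i => f i.succ) fun i => h i.succ)
    rw [Fin.prod_univ_succ, ← (Fin.consEquiv fun _ => ℕ).hasSum_iff]
    refine hm.congr_fun fun p => ?_
    simp [Fin.prod_univ_succ, Fin.consEquiv]

theorem exp_laguerreEigenvalue {d : ℕ} (α : Fin d → ℝ) (t : ℝ) (k : Fin d → ℕ) :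
    Real.exp (-t * laguerreEigenvalue α k) = ∏ i, Real.exp (-t * (k i + (α i + 1) / 2)) := by
  rw [← Real.exp_sum, ← Finset.mul_sum, laguerreEigenvalue, Finset.sum_add_distrib,
    ← Finset.sum_div, Finset.sum_add_distrib]
  simp

/-- The Laguerre heat kernel in several variables as a product of one-dimensional kernels. -/
noncomputable def laguerreHeatPi {d : ℕ} (α : Fin d → ℝ) (t : ℝ) (x y : Fin d → ℝ) : ℝ :=
  ∏ i, laguerreHeat (α i) t (x i) (y i)

section Kernel

variable {d : ℕ} {α : Fin d → ℝ}

theorem hasSum_laguerreHeatPi (hα : ∀ i, 0 ≤ α i) {t : ℝ} (ht : 0 < t)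
    {x y : Fin d → ℝ} (hx : x ∈ orthant d) (hy : y ∈ orthant d) :
    HasSum (fun k => Real.exp (-t * laguerreEigenvalue α k) * laguerreFun α k x * laguerreFun α k y)
      (laguerreHeatPi α t x y) := by
  refine (hasSum_prod_pi fun i => hasSum_laguerreHeat (hα i) ht (hx i) (hy i)).congr_fun
    fun k => ?_
  rw [exp_laguerreEigenvalue, Finset.prod_mul_distrib, Finset.prod_mul_distrib]
  rfl

/-- The series and the closed form are identified only on the orthant, which has full measure; the
operators are built from the closed form, whose measurability is immediate. -/
theorem laguerreKernel_eq (hα : ∀ i, 0 ≤ α i) {t : ℝ} (ht : 0 < t)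
    {x y : Fin d → ℝ} (hx : x ∈ orthant d) (hy : y ∈ orthant d) :
    laguerreKernel α t x y = laguerreHeatPi α t x y :=
  (hasSum_laguerreHeatPi hα ht hx hy).tsum_eq

theorem summable_exp_laguerreEigenvalue (α : Fin d → ℝ) {t : ℝ} (ht : 0 < t) :
    Summable fun k => Real.exp (-t * laguerreEigenvalue α k) := by
  simp only [exp_laguerreEigenvalue]
  refine (hasSum_prod_pi (f := fun i n => Real.exp (-t * (n + (α i + 1) / 2))) fun i =>
    Summable.hasSum ?_).summable
  have h := (summable_geometric_of_lt_one (Real.exp_pos (-t)).le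
    (Real.exp_lt_one_iff.2 (by linarith))).mul_right (Real.exp (-t * ((α i + 1) / 2)))
  refine h.congr fun n => ?_
  rw [← Real.exp_nat_mul, ← Real.exp_add]
  ring_nf

/-- From `|u| ≤ 1 + u²`: the weights alone are summable, and weighted squares sum to the kernel on
the diagonal. -/
theorem summable_exp_mul_abs_laguerreFun (hα : ∀ i, 0 ≤ α i) {t : ℝ} (ht : 0 < t)
    {x : Fin d → ℝ} (hx : x ∈ orthant d) :
    Summable fun k => |Real.exp (-t * laguerreEigenvalue α k) * laguerreFun α k x| := by
  refine ((summable_exp_laguerreEigenvalue α ht).add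
    (hasSum_laguerreHeatPi hα ht hx hx).summable).of_nonneg_of_le (fun k => abs_nonneg _)
    fun k => ?_
  rw [abs_mul, abs_of_pos (Real.exp_pos _), mul_assoc, ← sq, ← sq_abs]
  have h1 := Real.exp_pos (-t * laguerreEigenvalue α k)
  nlinarith [abs_nonneg (laguerreFun α k x), sq_nonneg (|laguerreFun α k x| - 1)]

theorem laguerreHeatPi_comm (t : ℝ) (x y : Fin d → ℝ) :
    laguerreHeatPi α t x y = laguerreHeatPi α t y x :=
  Finset.prod_congr rfl fun i _ => laguerreHeat_comm (α i) t (x i) (y i)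

theorem laguerreHeatPi_nonneg (hα : ∀ i, 0 ≤ α i) {t : ℝ} (ht : 0 < t)
    {x y : Fin d → ℝ} (hx : x ∈ orthant d) (hy : y ∈ orthant d) : 0 ≤ laguerreHeatPi α t x y :=
  Finset.prod_nonneg fun i _ => laguerreHeat_nonneg (hα i) ht (hx i) (hy i)

theorem laguerreHeatPi_le (hα : ∀ i, 0 ≤ α i) {t : ℝ} (ht : 0 < t)
    {x y : Fin d → ℝ} (hx : x ∈ orthant d) (hy : y ∈ orthant d) :
    laguerreHeatPi α t x y ≤ ((2 * Real.sinh (t / 2))⁻¹) ^ d := by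
  have h := Finset.prod_le_prod (s := Finset.univ)
    (fun i _ => laguerreHeat_nonneg (hα i) ht (hx i) (hy i))
    fun i _ => laguerreHeat_le (hα i) ht (hx i) (hy i)
  simpa [laguerreHeatPi] using h

theorem measurable_laguerreHeatPi (hα : ∀ i, 0 ≤ α i) (t : ℝ) :
    Measurable fun p : (Fin d → ℝ) × (Fin d → ℝ) => laguerreHeatPi α t p.1 p.2 := by
  unfold laguerreHeatPi
  refine Finset.measurable_prod _ fun i _ => ?_
  exact (measurable_laguerreHeat (hα i) t).comp (by fun_prop :
    Measurable fun p : (Fin d → ℝ) × (Fin d → ℝ) => (p.1 i, p.2 i))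

theorem measurable_laguerreHeatPi_right (hα : ∀ i, 0 ≤ α i) (t : ℝ) (x : Fin d → ℝ) :
    Measurable (laguerreHeatPi α t x) :=
  Measurable.of_uncurry_left (f := laguerreHeatPi α t) (measurable_laguerreHeatPi hα t)

theorem integrableOn_laguerreHeat {a : ℝ} (ha : 0 ≤ a) {t : ℝ} (ht : 0 < t) {x : ℝ}
    (hx : 0 < x) : IntegrableOn (laguerreHeat a t x) (Set.Ioi 0) := by
  refine ⟨((measurable_laguerreHeat ha t).comp measurable_prodMk_left).aestronglyMeasurable, ?_⟩
  rw [hasFiniteIntegral_iff_ofReal]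
  · exact (lintegral_laguerreHeat_le ha ht hx).trans_lt ENNReal.ofReal_lt_top
  · exact (ae_restrict_iff' measurableSet_Ioi).2
      (Eventually.of_forall fun u hu => laguerreHeat_nonneg ha ht hx hu)

theorem integral_laguerreHeat_le {a : ℝ} (ha : 0 ≤ a) {t : ℝ} (ht : 0 < t) {x : ℝ}
    (hx : 0 < x) : ∫ y in Set.Ioi (0 : ℝ), laguerreHeat a t x y ≤ (Real.cosh (t / 2))⁻¹ := by
  have h := lintegral_laguerreHeat_le ha ht hx
  rw [← ofReal_integral_eq_lintegral_ofReal (integrableOn_laguerreHeat ha ht hx)] at h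
  · exact (ENNReal.ofReal_le_ofReal_iff (inv_nonneg.2 (Real.cosh_pos _).le)).1 h
  · exact (ae_restrict_iff' measurableSet_Ioi).2
      (Eventually.of_forall fun u hu => laguerreHeat_nonneg ha ht hx hu)

theorem integrable_laguerreHeatPi (hα : ∀ i, 0 ≤ α i) {t : ℝ} (ht : 0 < t)
    {x : Fin d → ℝ} (hx : x ∈ orthant d) :
    Integrable (laguerreHeatPi α t x) (orthantMeasure d) := by
  rw [orthantMeasure_eq_pi]
  exact Integrable.fintype_prod (f := fun i y => laguerreHeat (α i) t (x i) y)
    fun i => integrableOn_laguerreHeat (hα i) ht (hx i)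

theorem integral_laguerreHeatPi_le (hα : ∀ i, 0 ≤ α i) {t : ℝ} (ht : 0 < t)
    {x : Fin d → ℝ} (hx : x ∈ orthant d) :
    ∫ y, laguerreHeatPi α t x y ∂orthantMeasure d ≤ (Real.cosh (t / 2) ^ d)⁻¹ := by
  rw [orthantMeasure_eq_pi]
  simp only [laguerreHeatPi]
  rw [integral_fintype_prod_eq_prod (f := fun i y => laguerreHeat (α i) t (x i) y)]
  have h := Finset.prod_le_prod (s := Finset.univ)
    (fun i _ => setIntegral_nonneg measurableSet_Ioi fun y (hy : 0 < y) =>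
      laguerreHeat_nonneg (hα i) ht (hx i) hy)
    fun i _ => integral_laguerreHeat_le (hα i) ht (hx i)
  simpa using h

theorem ae_laguerreHeatPi_nonneg (hα : ∀ i, 0 ≤ α i) {t : ℝ} (ht : 0 < t)
    {x : Fin d → ℝ} (hx : x ∈ orthant d) : 0 ≤ᵐ[orthantMeasure d] laguerreHeatPi α t x :=
  (ae_mem_orthant d).mono fun _ hy => laguerreHeatPi_nonneg hα ht hx hy

theorem lintegral_laguerreHeatPi_le (hα : ∀ i, 0 ≤ α i) {t : ℝ} (ht : 0 < t)
    {x : Fin d → ℝ} (hx : x ∈ orthant d) :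
    ∫⁻ y, ENNReal.ofReal (laguerreHeatPi α t x y) ∂orthantMeasure d ≤
      ENNReal.ofReal (Real.cosh (t / 2) ^ d)⁻¹ := by
  rw [← ofReal_integral_eq_lintegral_ofReal (integrable_laguerreHeatPi hα ht hx)
    (ae_laguerreHeatPi_nonneg hα ht hx)]
  exact ENNReal.ofReal_le_ofReal (integral_laguerreHeatPi_le hα ht hx)

theorem measurable_laguerreFun (α : Fin d → ℝ) (k : Fin d → ℕ) : Measurable (laguerreFun α k) := by
  unfold laguerreFun
  exact Finset.measurable_prod _ fun i _ =>
    (measurable_laguerreFun1 (α i) (k i)).comp (measurable_pi_apply i)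

theorem integrable_laguerreFun_mul (hα : ∀ i, 0 ≤ α i) (k l : Fin d → ℕ) :
    Integrable (fun x => laguerreFun α k x * laguerreFun α l x) (orthantMeasure d) := by
  rw [orthantMeasure_eq_pi]
  simp only [laguerreFun, ← Finset.prod_mul_distrib]
  exact Integrable.fintype_prod
    (f := fun i y => laguerreFun1 (α i) (k i) y * laguerreFun1 (α i) (l i) y)
    fun i => integrableOn_laguerreFun1_mul (hα i) (k i) (l i)

theorem integral_laguerreFun_mul (hα : ∀ i, 0 ≤ α i) (k l : Fin d → ℕ) :
    ∫ x, laguerreFun α k x * laguerreFun α l x ∂orthantMeasure d = if k = l then 1 else 0 := by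
  rw [orthantMeasure_eq_pi]
  simp only [laguerreFun, ← Finset.prod_mul_distrib]
  rw [integral_fintype_prod_eq_prod
    (f := fun i y => laguerreFun1 (α i) (k i) y * laguerreFun1 (α i) (l i) y)]
  simp only [integral_laguerreFun1_mul (hα _)]
  split_ifs with h
  · simp [h]
  · obtain ⟨i, hi⟩ := Function.ne_iff.1 h
    exact Finset.prod_eq_zero (Finset.mem_univ i) (if_neg hi)

/-! ### Pairing Laguerre expansions with square-integrable functions -/

variable {𝕜 : Type*} [RCLike 𝕜]

theorem memLp_laguerreFun (hα : ∀ i, 0 ≤ α i) (k : Fin d → ℕ) :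
    MemLp (fun x => (laguerreFun α k x : 𝕜)) 2 (orthantMeasure d) := by
  have hm : Measurable fun x => (laguerreFun α k x : 𝕜) :=
    RCLike.measurable_ofReal.comp (measurable_laguerreFun α k)
  rw [memLp_two_iff_integrable_sq_norm hm.aestronglyMeasurable]
  simpa [sq] using integrable_laguerreFun_mul hα k k

theorem integrable_laguerreFun_mul_of_memLp (hα : ∀ i, 0 ≤ α i) (k : Fin d → ℕ)
    {f : (Fin d → ℝ) → 𝕜} (hf : MemLp f 2 (orthantMeasure d)) :
    Integrable (fun y => (laguerreFun α k y : 𝕜) * f y) (orthantMeasure d) :=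
  (memLp_laguerreFun hα k).integrable_mul hf

theorem integral_norm_laguerreFun_mul_le (hα : ∀ i, 0 ≤ α i) (k : Fin d → ℕ)
    {f : (Fin d → ℝ) → 𝕜} (hf : MemLp f 2 (orthantMeasure d)) :
    ∫ y, ‖(laguerreFun α k y : 𝕜) * f y‖ ∂orthantMeasure d ≤
      1 + ∫ y, ‖f y‖ ^ 2 ∂orthantMeasure d := by
  have h1 := integrable_laguerreFun_mul hα k k
  have h2 := (memLp_two_iff_integrable_sq_norm hf.1).1 hf
  have e := integral_laguerreFun_mul hα k k
  rw [if_pos rfl] at e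
  rw [← e, ← integral_add h1 h2]
  refine integral_mono (integrable_laguerreFun_mul_of_memLp hα k hf).norm (h1.add h2) fun y => ?_
  simp only [norm_mul, RCLike.norm_ofReal]
  rw [← abs_mul_abs_self (laguerreFun α k y)]
  nlinarith [sq_nonneg (|laguerreFun α k y| - ‖f y‖), sq_nonneg (|laguerreFun α k y|),
    sq_nonneg ‖f y‖]

/-- The integrals of `|𝓛_k f|` are bounded uniformly in `k`, so absolutely summable coefficients
permit exchanging sum and integral. It serves both the heat kernel and the generating function in
the completeness proof. -/
theorem hasSum_integral_laguerreFun_mul (hα : ∀ i, 0 ≤ α i) {c : (Fin d → ℕ) → ℝ}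
    (hc : Summable fun k => |c k|) {g : (Fin d → ℝ) → ℝ}
    (hg : ∀ y ∈ orthant d, HasSum (fun k => c k * laguerreFun α k y) (g y))
    {f : (Fin d → ℝ) → 𝕜} (hf : MemLp f 2 (orthantMeasure d)) :
    HasSum (fun k => (c k : 𝕜) * ∫ y, (laguerreFun α k y : 𝕜) * f y ∂orthantMeasure d)
      (∫ y, (g y : 𝕜) * f y ∂orthantMeasure d) := by
  have h := hasSum_integral_of_summable_integral_norm (μ := orthantMeasure d)
    (F := fun k y => (c k : 𝕜) * ((laguerreFun α k y : 𝕜) * f y))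
    (fun k => (integrable_laguerreFun_mul_of_memLp hα k hf).const_mul _) ?_
  · simp only [integral_const_mul] at h
    rwa [integral_congr_ae (g := fun y => (g y : 𝕜) * f y)] at h
    filter_upwards [ae_mem_orthant d] with y hy
    simp only [← mul_assoc, ← RCLike.ofReal_mul]
    rw [tsum_mul_right, ← RCLike.ofReal_tsum, (hg y hy).tsum_eq]
  · refine (hc.mul_right (1 + ∫ y, ‖f y‖ ^ 2 ∂orthantMeasure d)).of_nonneg_of_le
      (fun k => integral_nonneg fun y => norm_nonneg _) fun k => ?_
    simp only [norm_mul (c k : 𝕜), RCLike.norm_ofReal, integral_const_mul]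
    exact mul_le_mul_of_nonneg_left (integral_norm_laguerreFun_mul_le hα k hf) (abs_nonneg _)

theorem hasSum_integral_laguerreHeatPi_mul (hα : ∀ i, 0 ≤ α i) {t : ℝ} (ht : 0 < t)
    {x : Fin d → ℝ} (hx : x ∈ orthant d) {f : (Fin d → ℝ) → 𝕜}
    (hf : MemLp f 2 (orthantMeasure d)) :
    HasSum (fun k => ((Real.exp (-t * laguerreEigenvalue α k) * laguerreFun α k x : ℝ) : 𝕜) *
      ∫ y, (laguerreFun α k y : 𝕜) * f y ∂orthantMeasure d)
      (∫ y, (laguerreHeatPi α t x y : 𝕜) * f y ∂orthantMeasure d) :=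
  hasSum_integral_laguerreFun_mul hα (summable_exp_mul_abs_laguerreFun hα ht hx)
    (fun _ hy => hasSum_laguerreHeatPi hα ht hx hy) hf

/-- The kernel is bounded and integrable in `y`, so its square is at most a constant times itself.
-/
theorem memLp_laguerreHeatPi (hα : ∀ i, 0 ≤ α i) {t : ℝ} (ht : 0 < t)
    {x : Fin d → ℝ} (hx : x ∈ orthant d) :
    MemLp (laguerreHeatPi α t x) 2 (orthantMeasure d) := by
  have hm := (measurable_laguerreHeatPi_right hα t x).aestronglyMeasurable (μ := orthantMeasure d)
  rw [memLp_two_iff_integrable_sq hm]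
  have hi := integrable_laguerreHeatPi hα ht hx
  refine (hi.const_mul (((2 * Real.sinh (t / 2))⁻¹) ^ d)).mono' (hm.pow 2) ?_
  filter_upwards [ae_mem_orthant d] with y hy
  have h0 := laguerreHeatPi_nonneg hα ht hx hy
  have h1 := laguerreHeatPi_le hα ht hx hy
  rw [Real.norm_of_nonneg (by positivity), sq]
  gcongr

theorem integral_laguerreFun_mul_laguerreHeatPi (hα : ∀ i, 0 ≤ α i) {t : ℝ} (ht : 0 < t)
    {x : Fin d → ℝ} (hx : x ∈ orthant d) (k : Fin d → ℕ) :
    ∫ y, laguerreFun α k y * laguerreHeatPi α t x y ∂orthantMeasure d =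
      Real.exp (-t * laguerreEigenvalue α k) * laguerreFun α k x := by
  have h := hasSum_integral_laguerreHeatPi_mul (𝕜 := ℝ) hα ht hx (memLp_laguerreFun hα k)
  simp only [RCLike.ofReal_real_eq_id, id, integral_laguerreFun_mul hα] at h
  simp only [mul_comm (laguerreFun α k _)]
  refine h.unique ((hasSum_ite_eq k
    (Real.exp (-t * laguerreEigenvalue α k) * laguerreFun α k x)).congr_fun fun l => ?_)
  split_ifs with hl
  · rw [hl, mul_one]
  · rw [mul_zero]

/-- Chapman–Kolmogorov: the first kernel is expanded, each `𝓛_k` is paired with the second kernel,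
of which it is an eigenfunction, and the exponentials multiply. -/
theorem integral_laguerreHeatPi_mul_laguerreHeatPi (hα : ∀ i, 0 ≤ α i) {s t : ℝ} (hs : 0 < s)
    (ht : 0 < t) {x y : Fin d → ℝ} (hx : x ∈ orthant d) (hy : y ∈ orthant d) :
    ∫ z, laguerreHeatPi α s x z * laguerreHeatPi α t z y ∂orthantMeasure d =
      laguerreHeatPi α (s + t) x y := by
  have h := hasSum_integral_laguerreHeatPi_mul (𝕜 := ℝ) hα hs hx (memLp_laguerreHeatPi hα ht hy)
  simp only [RCLike.ofReal_real_eq_id, id,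
    integral_laguerreFun_mul_laguerreHeatPi hα ht hy] at h
  simp only [laguerreHeatPi_comm t _ y]
  refine h.unique ((hasSum_laguerreHeatPi hα (add_pos hs ht) hx hy).congr_fun fun k => ?_)
  rw [neg_add, add_mul, Real.exp_add]
  ring

end Kernel

/-! ### Completeness of the Laguerre functions -/

section Completeness

variable {d : ℕ}

instance (d : ℕ) : PolishSpace (orthant d) := by
  have : IsOpen (orthant d) := by
    rw [orthant_eq_pi]
    exact isOpen_set_pi Set.finite_univ fun _ _ => isOpen_Ioi
  exact this.polishSpace

/-- The exponential `y ↦ exp (-∑ i, n i * y i)` as a bounded continuous function on the orthant. -/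
noncomputable def orthantExp (n : Fin d → ℕ) : BoundedContinuousFunction (orthant d) ℝ :=
  BoundedContinuousFunction.ofNormedAddCommGroup
    (fun y : orthant d => Real.exp (-∑ i, (n i : ℝ) * y.1 i)) 
    (Real.continuous_exp.comp (continuous_finsetSum _ fun i _ => continuous_const.mul
      ((continuous_apply i).comp continuous_subtype_val)).neg) 1 fun y => by
      rw [Real.norm_of_nonneg (Real.exp_pos _).le, Real.exp_le_one_iff, neg_nonpos]
      exact Finset.sum_nonneg fun i _ => mul_nonneg (Nat.cast_nonneg _) (y.2 i).le

theorem orthantExp_apply (n : Fin d → ℕ) (y : orthant d) :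
    orthantExp n y = Real.exp (-∑ i, (n i : ℝ) * y.1 i) := rfl

/-- The multiplicative monoid of the exponentials `orthantExp n`. -/
noncomputable def orthantExpHom (d : ℕ) :
    Multiplicative (Fin d → ℕ) →* BoundedContinuousFunction (orthant d) ℝ where
  toFun n := orthantExp n.toAdd
  map_one' := by
    ext y
    simp [orthantExp_apply]
  map_mul' m n := by
    ext y
    simp only [orthantExp_apply, BoundedContinuousFunction.mul_apply, ← Real.exp_add, toAdd_mul,
      Pi.add_apply, Nat.cast_add, add_mul, Finset.sum_add_distrib, neg_add]

/-- The algebra spanned by the exponentials `orthantExp n`. -/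
noncomputable def orthantExpAlgebra (d : ℕ) :
    StarSubalgebra ℝ (BoundedContinuousFunction (orthant d) ℝ) where
  toSubalgebra := Algebra.adjoin ℝ (MonoidHom.mrange (orthantExpHom d))
  star_mem' {g} hg := by
    have : star g = g := by
      ext y
      simp
    rwa [this]

theorem separatesPoints_orthantExpAlgebra (d : ℕ) :
    ((orthantExpAlgebra d).map
      (BoundedContinuousFunction.toContinuousMapStarₐ ℝ)).SeparatesPoints := by
  intro x y hxy
  obtain ⟨i, hi⟩ := Function.ne_iff.1 (Subtype.coe_ne_coe.2 hxy)
  have hmem : orthantExp (Pi.single i 1) ∈ orthantExpAlgebra d :=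
    Algebra.subset_adjoin ⟨Multiplicative.ofAdd (Pi.single i 1), rfl⟩
  refine ⟨orthantExp (Pi.single i 1), ⟨_, ⟨_, hmem, rfl⟩, rfl⟩, ?_⟩
  simp only [orthantExp_apply]
  intro h
  have h' := Real.exp_injective h
  simp only [Pi.single_apply, Nat.cast_ite, Nat.cast_one, Nat.cast_zero, ite_mul, one_mul,
    zero_mul, Finset.sum_ite_eq', Finset.mem_univ, if_true, neg_inj] at h'
  exact hi h'

/-- The positive and negative parts of `F` are densities of two finite measures that agree on the
exponentials. These span a point-separating algebra of bounded continuous functions, and the orthant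
is Polish, so the measures coincide. -/
theorem ae_eq_zero_of_integral_exp_mul_eq_zero {F : (Fin d → ℝ) → ℝ}
    (hF : Integrable F (orthantMeasure d))
    (h : ∀ n : Fin d → ℕ, ∫ y, Real.exp (-∑ i, (n i : ℝ) * y i) * F y ∂orthantMeasure d = 0) :
    F =ᵐ[orthantMeasure d] 0 := by
  set ν : Measure (orthant d) := Measure.comap Subtype.val volume with hν
  have hms := measurableSet_orthant d
  have hFν : Integrable (fun y : orthant d => F y) ν := by
    rw [orthantMeasure, ← map_comap_subtype_coe hms] at hF
    exact (MeasurableEmbedding.subtype_coe hms).integrable_map_iff.1 hF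
  have hexp : ∀ g : BoundedContinuousFunction (orthant d) ℝ, Integrable (fun y => g y * F y) ν :=
    fun g => hFν.bdd_mul g.continuous.measurable.aestronglyMeasurable
      (Eventually.of_forall fun y => g.norm_coe_le_norm y)
  set P : Measure (orthant d) := ν.withDensity fun y => ENNReal.ofReal (F y) with hP
  set P' : Measure (orthant d) := ν.withDensity fun y => ENNReal.ofReal (-F y) with hP'
  have : IsFiniteMeasure P := isFiniteMeasure_withDensity_ofReal hFν.2
  have : IsFiniteMeasure P' := isFiniteMeasure_withDensity_ofReal hFν.neg.2
  have hdiff : ∀ g : BoundedContinuousFunction (orthant d) ℝ,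
      ∫ y, g y ∂P - ∫ y, g y ∂P' = ∫ y, g y * F y ∂ν := by
    intro g
    have e : ∀ H : orthant d → ℝ, Integrable H ν →
        ∫ y, g y ∂(ν.withDensity fun y => ENNReal.ofReal (H y)) =
          ∫ y, max (H y) 0 * g y ∂ν := by
      intro H hH
      rw [integral_withDensity_eq_integral_toReal_smul₀ hH.1.aemeasurable.ennreal_ofReal
        (Eventually.of_forall fun y => ENNReal.ofReal_lt_top)]
      simp only [ENNReal.toReal_ofReal', smul_eq_mul]
    have i : ∀ H : orthant d → ℝ, Integrable H ν → Integrable (fun y => max (H y) 0 * g y) ν := by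
      intro H hH
      simp only [mul_comm _ (g _)]
      exact hH.pos_part.bdd_mul g.continuous.measurable.aestronglyMeasurable
        (Eventually.of_forall fun y => g.norm_coe_le_norm y)
    rw [hP, hP', e _ hFν, e (fun y => -F y) hFν.neg, ← integral_sub (i _ hFν) (i (fun y => -F y) hFν.neg)]
    refine integral_congr_ae (Eventually.of_forall fun y => ?_)
    change max (F y) 0 * g y - max (-F y) 0 * g y = g y * F y
    rw [← sub_mul, mul_comm (g y)]
    congr 1
    rcases le_total 0 (F y) with h0 | h0
    · rw [max_eq_left h0, max_eq_right (by linarith), sub_zero]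
    · rw [max_eq_right h0, max_eq_left (by linarith), zero_sub, neg_neg]
  have hPP : P = P' := by
    refine ext_of_forall_mem_subalgebra_integral_eq_of_polish
      (separatesPoints_orthantExpAlgebra d) fun g hg => ?_
    -- Exponentials are closed under multiplication, so the algebra they generate is just their
    -- linear span and linearity suffices.
    have hg' : g ∈ Submodule.span ℝ
        (MonoidHom.mrange (orthantExpHom d) : Set (BoundedContinuousFunction (orthant d) ℝ)) := by
      have : g ∈ Subalgebra.toSubmodule (Algebra.adjoin ℝ
        (MonoidHom.mrange (orthantExpHom d) : Set (BoundedContinuousFunction (orthant d) ℝ))) := hg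
      rwa [Algebra.adjoin_eq_span, Submonoid.closure_eq] at this
    rw [← sub_eq_zero, hdiff]
    clear hg
    induction hg' using Submodule.span_induction with
    | mem g hg =>
      obtain ⟨n, rfl⟩ := hg
      have := h n.toAdd
      rw [orthantMeasure, ← integral_subtype_comap hms] at this
      exact this
    | zero => simp
    | add f g _ _ hf hg =>
      simp only [BoundedContinuousFunction.coe_add, Pi.add_apply, add_mul]
      rw [integral_add (hexp f) (hexp g), hf, hg, add_zero]
    | smul c g _ hg =>
      simp only [BoundedContinuousFunction.coe_smul, smul_eq_mul, mul_assoc]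
      rw [integral_const_mul, hg, mul_zero]
  have hae := (withDensity_eq_iff hFν.1.aemeasurable.ennreal_ofReal
    hFν.1.aemeasurable.neg.ennreal_ofReal
    (by
      have := measure_ne_top P Set.univ
      rwa [hP, withDensity_apply _ MeasurableSet.univ, Measure.restrict_univ] at this)).1 hPP
  rw [orthantMeasure]
  refine (ae_restrict_iff_subtype hms).2 ?_
  filter_upwards [hae] with y hy
  have hy' : ENNReal.ofReal (F y) = ENNReal.ofReal (-F y) := hy
  rcases le_total 0 (F y) with h0 | h0
  · rw [ENNReal.ofReal_of_nonpos (neg_nonpos.2 h0), ENNReal.ofReal_eq_zero] at hy'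
    exact le_antisymm hy' h0
  · rw [ENNReal.ofReal_of_nonpos h0, eq_comm, ENNReal.ofReal_eq_zero] at hy'
    exact le_antisymm h0 (neg_nonpos.1 hy')

variable {𝕜 : Type*} [RCLike 𝕜]

theorem ae_eq_zero_of_integral_exp_mul_eq_zero' {F : (Fin d → ℝ) → 𝕜}
    (hF : Integrable F (orthantMeasure d))
    (h : ∀ n : Fin d → ℕ,
      ∫ y, (Real.exp (-∑ i, (n i : ℝ) * y i) : 𝕜) * F y ∂orthantMeasure d = 0) :
    F =ᵐ[orthantMeasure d] 0 := by
  have hint : ∀ n : Fin d → ℕ,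
      Integrable (fun y => (Real.exp (-∑ i, (n i : ℝ) * y i) : 𝕜) * F y) (orthantMeasure d) := by
    intro n
    refine hF.bdd_mul (c := 1) ?_ ?_
    · exact (RCLike.continuous_ofReal.comp (by fun_prop)).aestronglyMeasurable
    · filter_upwards [ae_mem_orthant d] with y hy
      rw [RCLike.norm_ofReal, abs_of_pos (Real.exp_pos _), Real.exp_le_one_iff, neg_nonpos]
      exact Finset.sum_nonneg fun i _ => mul_nonneg (Nat.cast_nonneg _) (hy i).le
  have hre := ae_eq_zero_of_integral_exp_mul_eq_zero hF.re fun n => by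
    have := integral_re (hint n)
    rw [h n, map_zero] at this
    simpa only [RCLike.re_ofReal_mul] using this
  have him := ae_eq_zero_of_integral_exp_mul_eq_zero hF.im fun n => by
    have := integral_im (hint n)
    rw [h n, map_zero] at this
    simpa only [RCLike.im_ofReal_mul] using this
  filter_upwards [hre, him] with y h1 h2
  exact RCLike.ext (by simpa using h1) (by simpa using h2)

/-! ### From Laguerre functions to exponentials -/

theorem laguerreFun1_zero {a : ℝ} (ha : 0 ≤ a) (x : ℝ) :
    laguerreFun1 a 0 x = (Real.sqrt (Real.Gamma (a + 1)))⁻¹ * (x ^ (a / 2) * Real.exp (-x / 2)) := by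
  have h := (Gamma_natCast_add_pos ha 0).ne'
  simp only [Nat.cast_zero, zero_add] at h
  simp [laguerreFun1, laguerrePoly, h]
  ring

theorem hasSum_pow_mul_laguerreFun1 {a : ℝ} (ha : 0 ≤ a) {s : ℝ} (hs : |s| < 1) (y : ℝ) :
    HasSum (fun k : ℕ => s ^ k * Real.sqrt (Real.Gamma (k + (a + 1)) / Nat.factorial k) *
      laguerreFun1 a k y)
      ((1 - s) ^ (-(a + 1)) * Real.sqrt (Real.Gamma (a + 1)) *
        (Real.exp (-(s / (1 - s) * y)) * laguerreFun1 a 0 y)) := by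
  have h := (hasSum_laguerrePoly_mul_pow ha y hs).mul_right (y ^ (a / 2) * Real.exp (-y / 2))
  have hg : 0 < Real.sqrt (Real.Gamma (a + 1)) :=
    Real.sqrt_pos.2 (Real.Gamma_pos_of_pos (by positivity))
  rw [laguerreFun1_zero ha, show s / (1 - s) * y = y * s / (1 - s) by ring,
    show ∀ A G E W : ℝ, A * G * (E * (G⁻¹ * W)) = (G * G⁻¹) * (A * E * W) from
      fun _ _ _ _ => by ring, mul_inv_cancel₀ hg.ne', one_mul]
  refine h.congr_fun fun k => ?_
  have h1 := Gamma_natCast_add_pos ha k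
  have e : Real.sqrt (Real.Gamma (k + (a + 1)) / Nat.factorial k) *
      Real.sqrt (Real.Gamma (k + 1) / Real.Gamma (k + a + 1)) = 1 := by
    rw [Real.Gamma_nat_eq_factorial, ← add_assoc, ← Real.sqrt_mul (by positivity),
      div_mul_div_cancel₀ (by positivity), div_self h1.ne', Real.sqrt_one]
  simp only [laguerreFun1]
  linear_combination (s ^ k * laguerrePoly a k y * y ^ (a / 2) * Real.exp (-y / 2)) * e

theorem summable_pow_mul_sqrt_Gamma {a : ℝ} (ha : 0 ≤ a) {s : ℝ} (hs0 : 0 ≤ s) (hs : s < 1) :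
    Summable fun k : ℕ => s ^ k * Real.sqrt (Real.Gamma (k + (a + 1)) / Nat.factorial k) := by
  have h := (hasSum_Gamma_div_factorial_mul_pow (c := a + 1) (by positivity)
    (show |s| < 1 by rwa [abs_of_nonneg hs0])).summable.add (summable_geometric_of_lt_one hs0 hs)
  refine h.of_nonneg_of_le (fun k => by positivity) fun k => ?_
  have h1 := Gamma_natCast_add_pos ha k
  rw [add_assoc] at h1
  have h2 : 0 ≤ Real.Gamma (k + (a + 1)) / Nat.factorial k := by positivity
  have h3 : Real.sqrt (Real.Gamma (k + (a + 1)) / Nat.factorial k) ≤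
      Real.Gamma (k + (a + 1)) / Nat.factorial k + 1 := by
    rw [Real.sqrt_le_left (by positivity)]
    nlinarith
  calc _ ≤ s ^ k * (Real.Gamma (k + (a + 1)) / Nat.factorial k + 1) := by gcongr
    _ = _ := by ring

/-- Summing the orthogonality relations with generating-function weights annihilates `exp (-n·y) 𝓛_0
f` for every `n`. Hence `𝓛_0 f = 0` almost everywhere, and `𝓛_0` is positive on the orthant. -/
theorem ae_eq_zero_of_integral_laguerreFun_mul_eq_zero {α : Fin d → ℝ} (hα : ∀ i, 0 ≤ α i)
    {f : (Fin d → ℝ) → 𝕜} (hf : MemLp f 2 (orthantMeasure d))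
    (h : ∀ k, ∫ y, (laguerreFun α k y : 𝕜) * f y ∂orthantMeasure d = 0) :
    f =ᵐ[orthantMeasure d] 0 := by
  have key : (fun y => (laguerreFun α 0 y : 𝕜) * f y) =ᵐ[orthantMeasure d] 0 := by
    refine ae_eq_zero_of_integral_exp_mul_eq_zero'
      (integrable_laguerreFun_mul_of_memLp hα 0 hf) fun n => ?_
    -- Chosen so that `s/(1-s) = n`, the rate of the exponential in the generating function.
    set s : Fin d → ℝ := fun i => n i / (n i + 1) with hs
    have hs0 : ∀ i, 0 ≤ s i := fun i => by positivity
    have hs1 : ∀ i, s i < 1 := fun i => by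
      rw [hs, div_lt_one (by positivity)]
      linarith
    have hsn : ∀ i, s i / (1 - s i) = n i := fun i => by
      have : (n i : ℝ) + 1 ≠ 0 := by positivity
      rw [hs]
      field_simp
      ring
    have hsum := hasSum_integral_laguerreFun_mul (𝕜 := 𝕜) hα
      (c := fun k => ∏ i, s i ^ k i * Real.sqrt (Real.Gamma (k i + (α i + 1)) / Nat.factorial (k i)))
      (g := fun y => ∏ i, ((1 - s i) ^ (-(α i + 1)) * Real.sqrt (Real.Gamma (α i + 1)) *
        (Real.exp (-(s i / (1 - s i) * y i)) * laguerreFun1 (α i) 0 (y i)))) ?_ ?_ hf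
    · simp only [h, mul_zero] at hsum
      have h0 := hsum.unique hasSum_zero
      set C : ℝ := ∏ i, (1 - s i) ^ (-(α i + 1)) * Real.sqrt (Real.Gamma (α i + 1)) with hC
      have hC0 : C ≠ 0 := by
        refine (Finset.prod_pos fun i _ => ?_).ne'
        have h1 := hs1 i
        have h2 : 0 < 1 - s i := by linarith
        have h3 : 0 < Real.sqrt (Real.Gamma (α i + 1)) :=
          Real.sqrt_pos.2 (Real.Gamma_pos_of_pos (by linarith [hα i]))
        positivity
      have e : ∀ y : Fin d → ℝ, ∏ i, ((1 - s i) ^ (-(α i + 1)) * Real.sqrt (Real.Gamma (α i + 1)) *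
          (Real.exp (-(s i / (1 - s i) * y i)) * laguerreFun1 (α i) 0 (y i))) =
          C * (Real.exp (-∑ i, (n i : ℝ) * y i) * laguerreFun α 0 y) := by
        intro y
        simp only [hsn]
        rw [Finset.prod_mul_distrib, ← hC, Finset.prod_mul_distrib, ← Real.exp_sum,
          Finset.sum_neg_distrib]
        rfl
      simp only [e] at h0
      simp only [RCLike.ofReal_mul, mul_assoc] at h0
      rw [integral_const_mul] at h0
      exact (mul_eq_zero.1 h0).resolve_left (RCLike.ofReal_ne_zero.2 hC0)
    · exact (hasSum_prod_pi fun i => (summable_pow_mul_sqrt_Gamma (hα i) (hs0 i) (hs1 i)).hasSum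
        ).summable.abs
    · intro y hy
      refine (hasSum_prod_pi fun i => hasSum_pow_mul_laguerreFun1 (hα i)
        (show |s i| < 1 by rw [abs_of_nonneg (hs0 i)]; exact hs1 i) (y i)).congr_fun fun k => ?_
      rw [laguerreFun, ← Finset.prod_mul_distrib]
  filter_upwards [key, ae_mem_orthant d] with y hy hyo
  refine (mul_eq_zero.1 hy).resolve_left ?_
  rw [RCLike.ofReal_eq_zero, laguerreFun]
  refine (Finset.prod_pos fun i _ => ?_).ne'
  have h1 : 0 < y i := hyo i
  have h2 : 0 < Real.sqrt (Real.Gamma (α i + 1)) :=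
    Real.sqrt_pos.2 (Real.Gamma_pos_of_pos (by linarith [hα i]))
  rw [Pi.zero_apply, laguerreFun1_zero (hα i)]
  positivity

end Completeness

/-! ### Symmetric integral operators on `L^1 + L^∞` -/

section SchurKernel

variable {X : Type*} [MeasurableSpace X] {μ : Measure X} {𝕜 : Type*} [RCLike 𝕜]

/-- The function is cut at height `1`: where `|f| > 1` one has `|f| ≤ |f|^p`, and elsewhere `f` is
bounded. -/
theorem memLp_mem_L1AddLinfty {p : ℝ≥0∞} (hp : 1 ≤ p) {f : X →ₘ[μ] 𝕜} (hf : MemLp f p μ) :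
    f ∈ L1AddLinfty 𝕜 μ := by
  rcases eq_or_ne p ∞ with rfl | hpt
  · exact Submodule.mem_sup_right (Lp.mem_Lp_iff_memLp.2 hf)
  have hfm := f.stronglyMeasurable
  set s : Set X := {x | 1 < ‖f x‖} with hs
  have hsm : MeasurableSet s := measurableSet_lt measurable_const hfm.norm.measurable
  have h1 : MemLp (s.indicator f) 1 μ := by
    refine ⟨(hfm.indicator hsm).aestronglyMeasurable, ?_⟩
    have hfin := hf.2
    rw [eLpNorm_lt_top_iff_lintegral_rpow_enorm_lt_top (by positivity) hpt] at hfin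
    rw [eLpNorm_one_eq_lintegral_enorm]
    refine lt_of_le_of_lt (lintegral_mono fun x => ?_) hfin
    by_cases hx : x ∈ s
    · rw [Set.indicator_of_mem hx]
      have h1p : 1 ≤ p.toReal := by
        rw [← ENNReal.toReal_one]
        exact ENNReal.toReal_mono hpt hp
      refine ENNReal.le_rpow_self_of_one_le ?_ h1p
      rw [← ofReal_norm, ENNReal.one_le_ofReal]
      exact le_of_lt hx
    · rw [Set.indicator_of_notMem hx]
      simp
  have h2 : MemLp (sᶜ.indicator f) ∞ μ := by
    refine memLp_top_of_bound (hfm.indicator hsm.compl).aestronglyMeasurable 1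
      (Eventually.of_forall fun x => ?_)
    by_cases hx : x ∈ s
    · rw [Set.indicator_of_notMem (by simpa using hx)]
      simp
    · rw [Set.indicator_of_mem hx]
      exact not_lt.1 hx
  have e : f = h1.toLp + (h2.toLp : X →ₘ[μ] 𝕜) := by
    refine AEEqFun.ext ?_
    filter_upwards [AEEqFun.coeFn_add (h1.toLp : X →ₘ[μ] 𝕜) h2.toLp, h1.coeFn_toLp, h2.coeFn_toLp]
      with x hx hx1 hx2
    rw [hx, Pi.add_apply, hx1, hx2, Set.indicator_self_add_compl_apply]
  rw [e]
  exact Submodule.add_mem_sup h1.toLp.2 h2.toLp.2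

/-- A symmetric measurable kernel which, on a set of full measure, is nonnegative, bounded by `B`
and has marginals of mass at most `C`. -/
structure IsSchurKernel (μ : Measure X) (S : Set X) (K : X → X → ℝ) (B C : ℝ) : Prop where
  ae_mem : ∀ᵐ x ∂μ, x ∈ S
  measurable : Measurable (Function.uncurry K)
  symm : ∀ x y, K x y = K y x
  nonneg : ∀ x ∈ S, ∀ y ∈ S, 0 ≤ K x y
  le : ∀ x ∈ S, ∀ y ∈ S, K x y ≤ B
  lintegral_le : ∀ x ∈ S, ∫⁻ y, ENNReal.ofReal (K x y) ∂μ ≤ ENNReal.ofReal C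

/-- The integral of a function against a real kernel. -/
noncomputable def kernelIntegral (μ : Measure X) (K : X → X → ℝ) (f : X → 𝕜) (x : X) : 𝕜 :=
  ∫ y, (K x y : 𝕜) * f y ∂μ

namespace IsSchurKernel

variable {S : Set X} {K : X → X → ℝ} {B C : ℝ}

theorem integrable_kernel (hK : IsSchurKernel μ S K B C) {x : X} (hx : x ∈ S) :
    Integrable (K x) μ := by
  refine ⟨hK.measurable.of_uncurry_left.aestronglyMeasurable, ?_⟩
  rw [hasFiniteIntegral_iff_ofReal (hK.ae_mem.mono fun y hy => hK.nonneg x hx y hy)]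
  exact (hK.lintegral_le x hx).trans_lt ENNReal.ofReal_lt_top

theorem integrable_mul (hK : IsSchurKernel μ S K B C) {f : X →ₘ[μ] 𝕜}
    (hf : f ∈ L1AddLinfty 𝕜 μ) {x : X} (hx : x ∈ S) :
    Integrable (fun y => (K x y : 𝕜) * f y) μ := by
  obtain ⟨g, hg, h, hh, rfl⟩ := Submodule.mem_sup.1 hf
  have hg' : Integrable g μ := memLp_one_iff_integrable.1 (Lp.mem_Lp_iff_memLp.1 hg)
  have hh' : MemLp h ∞ μ := Lp.mem_Lp_iff_memLp.1 hh
  have hKm : Measurable fun y => (K x y : 𝕜) :=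
    RCLike.measurable_ofReal.comp hK.measurable.of_uncurry_left
  have h1 : Integrable (fun y => (K x y : 𝕜) * g y) μ := by
    refine hg'.bdd_mul (c := B) hKm.aestronglyMeasurable (hK.ae_mem.mono fun y hy => ?_)
    rw [RCLike.norm_ofReal, abs_of_nonneg (hK.nonneg x hx y hy)]
    exact hK.le x hx y hy
  have h2 : Integrable (fun y => (K x y : 𝕜) * h y) μ := by
    simp only [mul_comm _ (h _)]
    refine (hK.integrable_kernel hx).ofReal.bdd_mul (c := (eLpNormEssSup h μ).toReal) hh'.1 ?_
    have hlt : eLpNormEssSup h μ < ∞ := by simpa using hh'.2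
    filter_upwards [ae_le_eLpNormEssSup (f := h) (μ := μ)] with y hy
    rw [← toReal_enorm]
    exact ENNReal.toReal_mono hlt.ne hy
  refine (h1.add h2).congr ?_
  filter_upwards [AEEqFun.coeFn_add g h] with y hy
  rw [hy, Pi.add_apply, Pi.add_apply, mul_add]

theorem enorm_kernelIntegral_le (hK : IsSchurKernel μ S K B C) (f : X →ₘ[μ] 𝕜) {x : X}
    (hx : x ∈ S) :
    ‖kernelIntegral μ K f x‖ₑ ≤
      eLpNorm f 1 (μ.withDensity fun y => ENNReal.ofReal (K x y)) := by
  have hm : Measurable fun y => ENNReal.ofReal (K x y) :=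
    hK.measurable.of_uncurry_left.ennreal_ofReal
  rw [eLpNorm_one_eq_lintegral_enorm,
    lintegral_withDensity_eq_lintegral_mul _ hm f.stronglyMeasurable.enorm]
  refine (enorm_integral_le_lintegral_enorm _).trans (lintegral_mono_ae ?_)
  filter_upwards [hK.ae_mem] with y hy
  rw [enorm_mul, Pi.mul_apply, ← ofReal_norm, RCLike.norm_ofReal,
    abs_of_nonneg (hK.nonneg x hx y hy)]

theorem withDensity_univ_le (hK : IsSchurKernel μ S K B C) {x : X} (hx : x ∈ S) :
    (μ.withDensity fun y => ENNReal.ofReal (K x y)) Set.univ ≤ ENNReal.ofReal C := by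
  rw [withDensity_apply _ MeasurableSet.univ, Measure.restrict_univ]
  exact hK.lintegral_le x hx

variable [SigmaFinite μ]

theorem stronglyMeasurable_kernelIntegral (hK : IsSchurKernel μ S K B C) (f : X →ₘ[μ] 𝕜) :
    StronglyMeasurable (kernelIntegral μ K f) := by
  have hKm : Measurable fun p : X × X => (K p.1 p.2 : 𝕜) :=
    RCLike.measurable_ofReal.comp hK.measurable
  exact StronglyMeasurable.integral_prod_right (f := fun x y => (K x y : 𝕜) * f y)
    (hKm.stronglyMeasurable.mul (f.stronglyMeasurable.comp_measurable measurable_snd))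

variable (𝕜) in
/-- The integral operator on `L^1 + L^∞` with a given kernel. -/
noncomputable def op (hK : IsSchurKernel μ S K B C) : L1AddLinfty 𝕜 μ →ₗ[𝕜] (X →ₘ[μ] 𝕜) where
  toFun f := AEEqFun.mk (kernelIntegral μ K f)
    (hK.stronglyMeasurable_kernelIntegral (f : X →ₘ[μ] 𝕜)).aestronglyMeasurable
  map_add' f g := by
    rw [AEEqFun.mk_add_mk, AEEqFun.mk_eq_mk]
    filter_upwards [hK.ae_mem] with x hx
    simp only [kernelIntegral, Pi.add_apply]
    rw [← integral_add (hK.integrable_mul f.2 hx) (hK.integrable_mul g.2 hx)]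
    refine integral_congr_ae ?_
    filter_upwards [AEEqFun.coeFn_add (f : X →ₘ[μ] 𝕜) g] with y hy
    rw [Submodule.coe_add, hy, Pi.add_apply, mul_add]
  map_smul' c f := by
    rw [RingHom.id_apply, AEEqFun.smul_mk, AEEqFun.mk_eq_mk]
    filter_upwards [hK.ae_mem] with x hx
    simp only [kernelIntegral, Pi.smul_apply]
    rw [← integral_smul]
    refine integral_congr_ae ?_
    filter_upwards [AEEqFun.coeFn_smul c (f : X →ₘ[μ] 𝕜)] with y hy
    rw [Submodule.coe_smul, hy, Pi.smul_apply, smul_eq_mul, smul_eq_mul, mul_left_comm]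

theorem coeFn_op (hK : IsSchurKernel μ S K B C) (f : L1AddLinfty 𝕜 μ) :
    hK.op 𝕜 f =ᵐ[μ] kernelIntegral μ K (f : X →ₘ[μ] 𝕜) :=
  AEEqFun.coeFn_mk _ _

/-- Schur test: Hölder's inequality for the measure `K(x,y) dμ(y)` of mass at most `C` gives a
pointwise bound; for finite `p`, Tonelli and the symmetry of `K` supply the second factor of `C`. -/
theorem eLpNorm_kernelIntegral_le (hK : IsSchurKernel μ S K B C) {p : ℝ≥0∞} (hp : 1 ≤ p)
    (f : X →ₘ[μ] 𝕜) :
    eLpNorm (kernelIntegral μ K f) p μ ≤ ENNReal.ofReal C * eLpNorm f p μ := by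
  have hKm : Measurable fun q : X × X => ENNReal.ofReal (K q.1 q.2) :=
    hK.measurable.ennreal_ofReal
  have hfm := f.stronglyMeasurable
  -- This covers `p = ∞` as well: there `p.toReal = 0` and `1 / 0 = 0`, so the exponent of `C` is
  -- `1`.
  have holder : ∀ x ∈ S, ‖kernelIntegral μ K f x‖ₑ ≤
      eLpNorm f p (μ.withDensity fun y => ENNReal.ofReal (K x y)) *
        ENNReal.ofReal C ^ (1 - 1 / p.toReal) := by
    intro x hx
    have h := eLpNorm_le_eLpNorm_mul_rpow_measure_univ hp (f := f)
      (μ := μ.withDensity fun y => ENNReal.ofReal (K x y)) hfm.aestronglyMeasurable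
    refine (hK.enorm_kernelIntegral_le f hx).trans (h.trans ?_)
    rw [ENNReal.toReal_one, div_one]
    have hexp : 0 ≤ 1 - 1 / p.toReal := by
      rcases eq_or_ne p ∞ with rfl | hpt
      · simp
      · have : 1 ≤ p.toReal := by
          rw [← ENNReal.toReal_one]
          exact ENNReal.toReal_mono hpt hp
        rw [sub_nonneg, div_le_one (by linarith)]
        exact this
    gcongr
    exact hK.withDensity_univ_le hx
  rcases eq_or_ne p ∞ with rfl | hpt
  · rw [eLpNorm_exponent_top]
    refine essSup_le_of_ae_le _ ?_
    filter_upwards [hK.ae_mem] with x hx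
    have h := holder x hx
    simp only [ENNReal.toReal_top, div_zero, sub_zero, ENNReal.rpow_one] at h
    rw [mul_comm]
    refine h.trans (mul_le_mul_left ?_ _)
    rw [eLpNorm_exponent_top, eLpNorm_exponent_top]
    exact essSup_mono_measure (withDensity_absolutelyContinuous _ _)
  · have hp0 : p ≠ 0 := (zero_lt_one.trans_le hp).ne'
    have h1p : 1 ≤ p.toReal := by
      rw [← ENNReal.toReal_one]
      exact ENNReal.toReal_mono hpt hp
    have hp0' : 0 < p.toReal := by linarith
    rw [eLpNorm_eq_lintegral_rpow_enorm_toReal hp0 hpt, eLpNorm_eq_lintegral_rpow_enorm_toReal hp0 hpt]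
    rw [one_div, ENNReal.rpow_inv_le_iff hp0', ENNReal.mul_rpow_of_nonneg _ _ hp0'.le,
      ENNReal.rpow_inv_rpow hp0'.ne']
    have hpt' : ∀ x ∈ S, ‖kernelIntegral μ K f x‖ₑ ^ p.toReal ≤
        ENNReal.ofReal C ^ (p.toReal - 1) *
          ∫⁻ y, ENNReal.ofReal (K x y) * ‖f y‖ₑ ^ p.toReal ∂μ := by
      intro x hx
      have hm : Measurable fun y => ENNReal.ofReal (K x y) :=
        hK.measurable.of_uncurry_left.ennreal_ofReal
      have h := ENNReal.rpow_le_rpow (holder x hx) hp0'.le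
      rw [ENNReal.mul_rpow_of_nonneg _ _ hp0'.le, eLpNorm_eq_lintegral_rpow_enorm_toReal hp0 hpt,
        one_div, ENNReal.rpow_inv_rpow hp0'.ne', ← ENNReal.rpow_mul,
        show (1 - p.toReal⁻¹) * p.toReal = p.toReal - 1 by field_simp,
        lintegral_withDensity_eq_lintegral_mul _ hm (hfm.enorm.pow_const _), mul_comm] at h
      exact h
    calc ∫⁻ x, ‖kernelIntegral μ K f x‖ₑ ^ p.toReal ∂μ
        ≤ ∫⁻ x, ENNReal.ofReal C ^ (p.toReal - 1) *
          ∫⁻ y, ENNReal.ofReal (K x y) * ‖f y‖ₑ ^ p.toReal ∂μ ∂μ :=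
          lintegral_mono_ae (hK.ae_mem.mono hpt')
      _ = ENNReal.ofReal C ^ (p.toReal - 1) *
          ∫⁻ y, ∫⁻ x, ENNReal.ofReal (K x y) * ‖f y‖ₑ ^ p.toReal ∂μ ∂μ := by
          have hjm : Measurable fun q : X × X => ENNReal.ofReal (K q.1 q.2) * ‖f q.2‖ₑ ^ p.toReal :=
            hKm.mul ((hfm.enorm.comp measurable_snd).pow_const _)
          rw [lintegral_const_mul _ hjm.lintegral_prod_right', lintegral_lintegral_swap
            hjm.aemeasurable]
      _ ≤ ENNReal.ofReal C ^ (p.toReal - 1) *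
          ∫⁻ y, ENNReal.ofReal C * ‖f y‖ₑ ^ p.toReal ∂μ := by
          refine mul_le_mul_right (lintegral_mono_ae ?_) _
          filter_upwards [hK.ae_mem] with y hy
          simp only [hK.symm _ y]
          rw [lintegral_mul_const _ hK.measurable.of_uncurry_left.ennreal_ofReal]
          exact mul_le_mul_left (hK.lintegral_le y hy) _
      _ = ENNReal.ofReal C ^ p.toReal * ∫⁻ y, ‖f y‖ₑ ^ p.toReal ∂μ := by
          rw [lintegral_const_mul _ (hfm.enorm.pow_const _), ← mul_assoc]
          congr 1
          nth_rewrite 2 [← ENNReal.rpow_one (ENNReal.ofReal C)]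
          rw [← ENNReal.rpow_add_of_nonneg _ _ (by linarith) zero_le_one, sub_add_cancel]

theorem kernelIntegral_kernelIntegral {K₁ K₂ K₃ : X → X → ℝ} {B₁ B₂ B₃ C₁ C₂ C₃ : ℝ}
    (h₁ : IsSchurKernel μ S K₁ B₁ C₁) (h₂ : IsSchurKernel μ S K₂ B₂ C₂)
    (h₃ : IsSchurKernel μ S K₃ B₃ C₃)
    (h : ∀ x ∈ S, ∀ y ∈ S, ∫ z, K₁ x z * K₂ z y ∂μ = K₃ x y) {f : X →ₘ[μ] 𝕜}
    (hf : f ∈ L1AddLinfty 𝕜 μ) {x : X} (hx : x ∈ S) :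
    kernelIntegral μ K₁ (kernelIntegral μ K₂ f) x = kernelIntegral μ K₃ f x := by
  have hm₁ : Measurable fun z => (K₁ x z : 𝕜) :=
    RCLike.measurable_ofReal.comp h₁.measurable.of_uncurry_left
  have hm₂ : Measurable fun q : X × X => (K₂ q.1 q.2 : 𝕜) :=
    RCLike.measurable_ofReal.comp h₂.measurable
  have hmeas : StronglyMeasurable
      (Function.uncurry fun z y => (K₁ x z : 𝕜) * ((K₂ z y : 𝕜) * f y)) :=
    (hm₁.comp measurable_fst).stronglyMeasurable.mul
      (hm₂.stronglyMeasurable.mul (f.stronglyMeasurable.comp_measurable measurable_snd))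
  have hint : ∀ y ∈ S, Integrable (fun z => K₁ x z * K₂ z y) μ := by
    intro y hy
    simp only [mul_comm (K₁ x _), h₂.symm _ y]
    refine (h₁.integrable_kernel hx).bdd_mul (c := B₂)
      h₂.measurable.of_uncurry_left.aestronglyMeasurable (h₂.ae_mem.mono fun z hz => ?_)
    rw [Real.norm_of_nonneg (h₂.nonneg y hy z hz)]
    exact h₂.le y hy z hz
  -- The kernels being nonnegative, integrating the norm over `z` gives `K₃(x,y) |f(y)|`, which is
  -- integrable in `y`.
  have hprod : Integrable (Function.uncurry fun z y => (K₁ x z : 𝕜) * ((K₂ z y : 𝕜) * f y))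
      (μ.prod μ) := by
    rw [integrable_prod_iff' hmeas.aestronglyMeasurable]
    constructor
    · filter_upwards [h₂.ae_mem] with y hy
      refine ((hint y hy).ofReal (𝕜 := 𝕜) |>.mul_const (f y)).congr (Eventually.of_forall fun z => ?_)
      simp only [Function.uncurry_apply_pair, RCLike.ofReal_mul, mul_assoc]
    · refine (h₃.integrable_mul hf hx).norm.congr ?_
      filter_upwards [h₂.ae_mem] with y hy
      rw [norm_mul, RCLike.norm_ofReal, abs_of_nonneg (h₃.nonneg x hx y hy), ← h x hx y hy,
        ← integral_mul_const]
      refine integral_congr_ae ?_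
      filter_upwards [h₁.ae_mem] with z hz
      simp only [Function.uncurry_apply_pair, norm_mul, RCLike.norm_ofReal,
        abs_of_nonneg (h₁.nonneg x hx z hz), abs_of_nonneg (h₂.nonneg z hz y hy), mul_assoc]
  calc kernelIntegral μ K₁ (kernelIntegral μ K₂ f) x
      = ∫ z, ∫ y, (K₁ x z : 𝕜) * ((K₂ z y : 𝕜) * f y) ∂μ ∂μ := by
        simp only [kernelIntegral, integral_const_mul]
    _ = ∫ y, ∫ z, (K₁ x z : 𝕜) * ((K₂ z y : 𝕜) * f y) ∂μ ∂μ := integral_integral_swap hprod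
    _ = kernelIntegral μ K₃ f x := by
        refine integral_congr_ae ?_
        filter_upwards [h₂.ae_mem] with y hy
        simp only [← mul_assoc, ← RCLike.ofReal_mul]
        rw [integral_mul_const, integral_ofReal, h x hx y hy]

theorem integrable_prod_kernel_mul_norm_sq (hK : IsSchurKernel μ S K B C) {g : X → 𝕜}
    (hgm : StronglyMeasurable g) (hg : MemLp g 2 μ) :
    Integrable (fun q : X × X => K q.1 q.2 * ‖g q.1‖ ^ 2) (μ.prod μ) := by
  have hm : StronglyMeasurable fun q : X × X => K q.1 q.2 * ‖g q.1‖ ^ 2 :=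
    hK.measurable.stronglyMeasurable.mul ((hgm.comp_measurable measurable_fst).norm.pow 2)
  have hg2 := (memLp_two_iff_integrable_sq_norm hg.1).1 hg
  rw [integrable_prod_iff hm.aestronglyMeasurable]
  refine ⟨hK.ae_mem.mono fun x hx => (hK.integrable_kernel hx).mul_const (‖g x‖ ^ 2), ?_⟩
  refine (hg2.const_mul (max C 0)).mono' hm.norm.integral_prod_right'.aestronglyMeasurable ?_
  filter_upwards [hK.ae_mem] with x hx
  have hnn : 0 ≤ᵐ[μ] K x := hK.ae_mem.mono fun y hy => hK.nonneg x hx y hy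
  have hle : ∫ y, K x y ∂μ ≤ max C 0 := by
    rw [integral_eq_lintegral_of_nonneg_ae hnn hK.measurable.of_uncurry_left.aestronglyMeasurable,
      ← ENNReal.toReal_ofReal']
    exact ENNReal.toReal_mono ENNReal.ofReal_ne_top (hK.lintegral_le x hx)
  rw [Real.norm_of_nonneg (integral_nonneg fun y => norm_nonneg _)]
  calc ∫ y, ‖K x y * ‖g x‖ ^ 2‖ ∂μ = ∫ y, K x y * ‖g x‖ ^ 2 ∂μ := by
        refine integral_congr_ae ?_
        filter_upwards [hnn] with y hy
        exact Real.norm_of_nonneg (mul_nonneg hy (by positivity))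
    _ = (∫ y, K x y ∂μ) * ‖g x‖ ^ 2 := integral_mul_const _ _
    _ ≤ max C 0 * ‖g x‖ ^ 2 := by gcongr

theorem integral_mul_kernelIntegral (hK : IsSchurKernel μ S K B C) {f g : X → 𝕜}
    (hfm : StronglyMeasurable f) (hf : MemLp f 2 μ) (hgm : StronglyMeasurable g)
    (hg : MemLp g 2 μ) :
    ∫ x, g x * kernelIntegral μ K f x ∂μ = ∫ y, kernelIntegral μ K g y * f y ∂μ := by
  have hKm : Measurable fun q : X × X => (K q.1 q.2 : 𝕜) :=
    RCLike.measurable_ofReal.comp hK.measurable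
  have hm : StronglyMeasurable (Function.uncurry fun x y => g x * ((K x y : 𝕜) * f y)) :=
    (hgm.comp_measurable measurable_fst).mul
      (hKm.stronglyMeasurable.mul (hfm.comp_measurable measurable_snd))
  -- The integrand is dominated by `K(x,y) (|g(x)|² + |f(y)|²)`; the two summands are exchanged by
  -- symmetry of `K`.
  have hint : Integrable (Function.uncurry fun x y => g x * ((K x y : 𝕜) * f y)) (μ.prod μ) := by
    refine ((hK.integrable_prod_kernel_mul_norm_sq hgm hg).add
      (hK.integrable_prod_kernel_mul_norm_sq hfm hf).swap).mono' hm.aestronglyMeasurable ?_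
    filter_upwards [Measure.quasiMeasurePreserving_fst.ae hK.ae_mem,
      Measure.quasiMeasurePreserving_snd.ae hK.ae_mem] with q h1 h2
    have h0 := hK.nonneg _ h1 _ h2
    simp only [Function.uncurry, norm_mul, RCLike.norm_ofReal, abs_of_nonneg h0, Pi.add_apply,
      Function.comp, Prod.fst_swap, Prod.snd_swap, hK.symm q.2 q.1]
    rw [← mul_add, mul_left_comm]
    refine mul_le_mul_of_nonneg_left ?_ h0
    nlinarith [sq_nonneg (‖g q.1‖ - ‖f q.2‖), sq_nonneg ‖g q.1‖, sq_nonneg ‖f q.2‖]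
  calc ∫ x, g x * kernelIntegral μ K f x ∂μ = ∫ x, ∫ y, g x * ((K x y : 𝕜) * f y) ∂μ ∂μ := by
        simp only [kernelIntegral, integral_const_mul]
    _ = ∫ y, ∫ x, g x * ((K x y : 𝕜) * f y) ∂μ ∂μ := integral_integral_swap hint
    _ = ∫ y, kernelIntegral μ K g y * f y ∂μ := by
        refine integral_congr_ae (Eventually.of_forall fun y => ?_)
        simp only [kernelIntegral, hK.symm _ y]
        rw [← integral_mul_const]
        refine integral_congr_ae (Eventually.of_forall fun x => ?_)
        ring

end IsSchurKernel

theorem exists_actsOnLpAs {T : L1AddLinfty 𝕜 μ →ₗ[𝕜] (X →ₘ[μ] 𝕜)} {p : ℝ≥0∞} [hp : Fact (1 ≤ p)]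
    {C : ℝ} (hC : 0 ≤ C)
    (hT : ∀ f : L1AddLinfty 𝕜 μ, eLpNorm (T f) p μ ≤
      ENNReal.ofReal C * eLpNorm (f : X →ₘ[μ] 𝕜) p μ) :
    ∃ A : Lp 𝕜 p μ →L[𝕜] Lp 𝕜 p μ, ActsOnLpAs T p A ∧ ‖A‖ ≤ C := by
  have hmem : ∀ f : Lp 𝕜 p μ, (f : X →ₘ[μ] 𝕜) ∈ L1AddLinfty 𝕜 μ := fun f =>
    memLp_mem_L1AddLinfty hp.out (Lp.memLp f)
  have hTmem : ∀ f : Lp 𝕜 p μ, T ⟨f, hmem f⟩ ∈ Lp 𝕜 p μ := fun f =>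
    Lp.mem_Lp_iff_eLpNorm_lt_top.2 ((hT ⟨f, hmem f⟩).trans_lt
      (ENNReal.mul_lt_top ENNReal.ofReal_lt_top (Lp.eLpNorm_lt_top f)))
  let A : Lp 𝕜 p μ →ₗ[𝕜] Lp 𝕜 p μ :=
    { toFun := fun f => ⟨T ⟨f, hmem f⟩, hTmem f⟩
      map_add' := fun f g => Subtype.ext (T.map_add ⟨f, hmem f⟩ ⟨g, hmem g⟩)
      map_smul' := fun c f => Subtype.ext (T.map_smul c ⟨f, hmem f⟩) }
  have hA : ∀ f, ‖A f‖ ≤ C * ‖f‖ := by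
    intro f
    rw [Lp.norm_def, Lp.norm_def, ← ENNReal.toReal_ofReal hC, ← ENNReal.toReal_mul]
    exact ENNReal.toReal_mono
      (ENNReal.mul_lt_top ENNReal.ofReal_lt_top (Lp.eLpNorm_lt_top f)).ne (hT ⟨f, hmem f⟩)
  exact ⟨A.mkContinuous C hA, fun f => ⟨hmem f, rfl⟩, A.mkContinuous_norm_le hC hA⟩

end SchurKernel

/-! ### The Laguerre semigroup -/

section LaguerreSemigroup

variable {𝕜 : Type*} [RCLike 𝕜] {d : ℕ} {α : Fin d → ℝ}

theorem isSchurKernel_laguerreHeatPi (hα : ∀ i, 0 ≤ α i) {t : ℝ} (ht : 0 < t) :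
    IsSchurKernel (orthantMeasure d) (orthant d) (laguerreHeatPi α t)
      (((2 * Real.sinh (t / 2))⁻¹) ^ d) (Real.cosh (t / 2) ^ d)⁻¹ where
  ae_mem := ae_mem_orthant d
  measurable := measurable_laguerreHeatPi hα t
  symm := laguerreHeatPi_comm t
  nonneg _ hx _ hy := laguerreHeatPi_nonneg hα ht hx hy
  le _ hx _ hy := laguerreHeatPi_le hα ht hx hy
  lintegral_le _ hx := lintegral_laguerreHeatPi_le hα ht hx

theorem laguerreEigenvalue_nonneg (hα : ∀ i, 0 ≤ α i) (k : Fin d → ℕ) :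
    0 ≤ laguerreEigenvalue α k := by
  have := Finset.sum_nonneg fun i (_ : i ∈ Finset.univ) => hα i
  unfold laguerreEigenvalue
  positivity

theorem stronglyMeasurable_laguerreFun (α : Fin d → ℝ) (k : Fin d → ℕ) :
    StronglyMeasurable fun x => (laguerreFun α k x : 𝕜) :=
  (RCLike.measurable_ofReal.comp (measurable_laguerreFun α k)).stronglyMeasurable

theorem inner_toLp_laguerreFun (hα : ∀ i, 0 ≤ α i) (k : Fin d → ℕ)
    (f : Lp 𝕜 2 (orthantMeasure d)) :
    inner 𝕜 ((memLp_laguerreFun (𝕜 := 𝕜) hα k).toLp) f =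
      ∫ x, (laguerreFun α k x : 𝕜) * f x ∂orthantMeasure d := by
  rw [L2.inner_def]
  refine integral_congr_ae ?_
  filter_upwards [(memLp_laguerreFun (𝕜 := 𝕜) hα k).coeFn_toLp] with x hx
  rw [hx, RCLike.inner_apply, RCLike.conj_ofReal, mul_comm]

theorem orthonormal_laguerreFun (hα : ∀ i, 0 ≤ α i) :
    Orthonormal 𝕜 fun k => (memLp_laguerreFun (𝕜 := 𝕜) hα k).toLp := by
  classical
  rw [orthonormal_iff_ite]
  intro k l
  rw [inner_toLp_laguerreFun hα]
  have e : ∫ x, (laguerreFun α k x : 𝕜) *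
      ((memLp_laguerreFun (𝕜 := 𝕜) hα l).toLp : (Fin d → ℝ) → 𝕜) x ∂orthantMeasure d =
      ∫ x, ((laguerreFun α k x * laguerreFun α l x : ℝ) : 𝕜) ∂orthantMeasure d := by
    refine integral_congr_ae ?_
    filter_upwards [(memLp_laguerreFun (𝕜 := 𝕜) hα l).coeFn_toLp] with x hx
    rw [hx, RCLike.ofReal_mul]
  rw [e, integral_ofReal, integral_laguerreFun_mul hα]
  split_ifs <;> simp

variable (𝕜) in
/-- The Laguerre functions as a Hilbert basis of `L^2` of the orthant. -/
noncomputable def laguerreBasis (hα : ∀ i, 0 ≤ α i) :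
    HilbertBasis (Fin d → ℕ) 𝕜 (Lp 𝕜 2 (orthantMeasure d)) :=
  HilbertBasis.mkOfOrthogonalEqBot (orthonormal_laguerreFun hα) (by
    rw [Submodule.eq_bot_iff]
    intro f hf
    refine Lp.ext ?_
    have h0 := ae_eq_zero_of_integral_laguerreFun_mul_eq_zero hα (Lp.memLp f) fun k => by
      rw [← inner_toLp_laguerreFun hα]
      exact (Submodule.mem_orthogonal _ _).1 hf _ (Submodule.subset_span ⟨k, rfl⟩)
    exact h0.trans (Lp.coeFn_zero 𝕜 2 (orthantMeasure d)).symm)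

theorem laguerreBasis_apply (hα : ∀ i, 0 ≤ α i) (k : Fin d → ℕ) :
    laguerreBasis 𝕜 hα k = (memLp_laguerreFun (𝕜 := 𝕜) hα k).toLp := by
  rw [laguerreBasis, HilbertBasis.coe_mkOfOrthogonalEqBot]

variable (𝕜) in
/-- The Laguerre semigroup on `L^1 + L^∞` of the orthant. -/
noncomputable def laguerreSemigroup (hα : ∀ i, 0 ≤ α i) (t : ℝ≥0) :
    L1AddLinfty 𝕜 (orthantMeasure d) →ₗ[𝕜] ((Fin d → ℝ) →ₘ[orthantMeasure d] 𝕜) :=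
  if ht : 0 < (t : ℝ) then (isSchurKernel_laguerreHeatPi hα ht).op 𝕜
  else (L1AddLinfty 𝕜 (orthantMeasure d)).subtype

theorem laguerreSemigroup_zero (hα : ∀ i, 0 ≤ α i) :
    laguerreSemigroup 𝕜 hα 0 = (L1AddLinfty 𝕜 (orthantMeasure d)).subtype := by
  simp [laguerreSemigroup]

theorem laguerreSemigroup_of_pos (hα : ∀ i, 0 ≤ α i) {t : ℝ≥0} (ht : 0 < (t : ℝ)) :
    laguerreSemigroup 𝕜 hα t = (isSchurKernel_laguerreHeatPi hα ht).op 𝕜 := by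
  rw [laguerreSemigroup, dif_pos ht]

theorem coeFn_laguerreSemigroup (hα : ∀ i, 0 ≤ α i) {t : ℝ≥0} (ht : 0 < (t : ℝ))
    (f : L1AddLinfty 𝕜 (orthantMeasure d)) :
    laguerreSemigroup 𝕜 hα t f =ᵐ[orthantMeasure d] kernelIntegral (orthantMeasure d)
      (laguerreHeatPi α t) (f : (Fin d → ℝ) →ₘ[orthantMeasure d] 𝕜) := by
  rw [laguerreSemigroup_of_pos hα ht]
  exact (isSchurKernel_laguerreHeatPi hα ht).coeFn_op f

theorem eLpNorm_laguerreSemigroup_le (hα : ∀ i, 0 ≤ α i) {p : ℝ≥0∞} (hp : 1 ≤ p) (t : ℝ≥0)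
    (f : L1AddLinfty 𝕜 (orthantMeasure d)) :
    eLpNorm (laguerreSemigroup 𝕜 hα t f) p (orthantMeasure d) ≤
      ENNReal.ofReal (Real.cosh (t / 2) ^ d)⁻¹ *
        eLpNorm (f : (Fin d → ℝ) →ₘ[orthantMeasure d] 𝕜) p (orthantMeasure d) := by
  rcases eq_or_ne t 0 with rfl | ht
  · simp [laguerreSemigroup_zero]
  · have ht' : 0 < (t : ℝ) := by positivity
    rw [eLpNorm_congr_ae (coeFn_laguerreSemigroup hα ht' f)]
    exact (isSchurKernel_laguerreHeatPi hα ht').eLpNorm_kernelIntegral_le hp _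

theorem exists_actsOnLpAs_laguerreSemigroup (hα : ∀ i, 0 ≤ α i) (p : ℝ≥0∞) [hp : Fact (1 ≤ p)]
    (t : ℝ≥0) :
    ∃ A : Lp 𝕜 p (orthantMeasure d) →L[𝕜] Lp 𝕜 p (orthantMeasure d),
      ActsOnLpAs (laguerreSemigroup 𝕜 hα t) p A ∧ ‖A‖ ≤ (Real.cosh (t / 2) ^ d)⁻¹ :=
  exists_actsOnLpAs (inv_nonneg.2 (pow_nonneg (Real.cosh_pos _).le _))
    (eLpNorm_laguerreSemigroup_le hα hp.out t)

theorem laguerreSemigroup_add (hα : ∀ i, 0 ≤ α i) (s t : ℝ≥0)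
    (f : L1AddLinfty 𝕜 (orthantMeasure d))
    (hf : laguerreSemigroup 𝕜 hα t f ∈ L1AddLinfty 𝕜 (orthantMeasure d)) :
    laguerreSemigroup 𝕜 hα s ⟨laguerreSemigroup 𝕜 hα t f, hf⟩ =
      laguerreSemigroup 𝕜 hα (s + t) f := by
  rcases eq_or_ne s 0 with rfl | hs
  · simp [laguerreSemigroup_zero]
  rcases eq_or_ne t 0 with rfl | ht
  · simp [laguerreSemigroup_zero]
  have hs' : 0 < (s : ℝ) := by positivity
  have ht' : 0 < (t : ℝ) := by positivity
  have hst : 0 < ((s + t : ℝ≥0) : ℝ) := by positivity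
  refine AEEqFun.ext ?_
  filter_upwards [coeFn_laguerreSemigroup hα hs' ⟨laguerreSemigroup 𝕜 hα t f, hf⟩,
    coeFn_laguerreSemigroup hα hst f, ae_mem_orthant d] with x h1 h2 hx
  rw [h1, h2, ← (isSchurKernel_laguerreHeatPi hα hs').kernelIntegral_kernelIntegral
    (isSchurKernel_laguerreHeatPi hα ht') (isSchurKernel_laguerreHeatPi hα hst)
    (fun x hx y hy => by
      rw [integral_laguerreHeatPi_mul_laguerreHeatPi hα hs' ht' hx hy, NNReal.coe_add]) f.2 hx]
  refine integral_congr_ae ?_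
  filter_upwards [coeFn_laguerreSemigroup hα ht' f] with y hy
  rw [hy]

theorem kernelIntegral_laguerreFun (hα : ∀ i, 0 ≤ α i) {t : ℝ} (ht : 0 < t) (k : Fin d → ℕ)
    {x : Fin d → ℝ} (hx : x ∈ orthant d) :
    kernelIntegral (orthantMeasure d) (laguerreHeatPi α t) (fun y => (laguerreFun α k y : 𝕜)) x =
      (Real.exp (-t * laguerreEigenvalue α k) : 𝕜) * (laguerreFun α k x : 𝕜) := by
  simp only [kernelIntegral, ← RCLike.ofReal_mul]
  rw [integral_ofReal, ← integral_laguerreFun_mul_laguerreHeatPi hα ht hx k]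
  simp only [mul_comm]

/-- The operator is diagonal in the Laguerre basis: the symmetric real kernel is moved onto `𝓛_k`,
which is its eigenfunction. All the `L^2` assertions follow from this. -/
theorem inner_laguerreBasis_of_actsOnLpAs (hα : ∀ i, 0 ≤ α i) {t : ℝ≥0}
    {A : Lp 𝕜 2 (orthantMeasure d) →L[𝕜] Lp 𝕜 2 (orthantMeasure d)}
    (hA : ActsOnLpAs (laguerreSemigroup 𝕜 hα t) 2 A) (k : Fin d → ℕ)
    (f : Lp 𝕜 2 (orthantMeasure d)) :
    inner 𝕜 (laguerreBasis 𝕜 hα k) (A f) =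
      (Real.exp (-t * laguerreEigenvalue α k) : 𝕜) * inner 𝕜 (laguerreBasis 𝕜 hα k) f := by
  obtain ⟨hf, hAf⟩ := hA f
  rcases eq_or_ne t 0 with rfl | ht
  · rw [laguerreSemigroup_zero] at hAf
    have : A f = f := Subtype.ext hAf.symm
    simp [this]
  have ht' : 0 < (t : ℝ) := by positivity
  rw [laguerreBasis_apply, inner_toLp_laguerreFun hα, inner_toLp_laguerreFun hα, ← integral_const_mul]
  have hc := coeFn_laguerreSemigroup hα ht' ⟨(f : (Fin d → ℝ) →ₘ[orthantMeasure d] 𝕜), hf⟩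
  rw [hAf] at hc
  calc ∫ x, (laguerreFun α k x : 𝕜) * A f x ∂orthantMeasure d
      = ∫ x, (laguerreFun α k x : 𝕜) *
        kernelIntegral (orthantMeasure d) (laguerreHeatPi α t) f x ∂orthantMeasure d := by
        refine integral_congr_ae ?_
        filter_upwards [hc] with x hx
        rw [hx]
    _ = ∫ y, kernelIntegral (orthantMeasure d) (laguerreHeatPi α t)
        (fun y => (laguerreFun α k y : 𝕜)) y * f y ∂orthantMeasure d :=
        (isSchurKernel_laguerreHeatPi hα ht').integral_mul_kernelIntegral
          (Lp.stronglyMeasurable f) (Lp.memLp f) (stronglyMeasurable_laguerreFun α k)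
          (memLp_laguerreFun hα k)
    _ = _ := by
        refine integral_congr_ae ?_
        filter_upwards [ae_mem_orthant d] with y hy
        rw [kernelIntegral_laguerreFun hα ht' k hy, mul_assoc]

theorem isLaguerreExp_of_actsOnLpAs (hα : ∀ i, 0 ≤ α i) {t : ℝ≥0}
    {A : Lp 𝕜 2 (orthantMeasure d) →L[𝕜] Lp 𝕜 2 (orthantMeasure d)}
    (hA : ActsOnLpAs (laguerreSemigroup 𝕜 hα t) 2 A) : IsLaguerreExp α t A := by
  refine ⟨fun k x hx => laguerreDiffOp_laguerreFun hα k hx, laguerreBasis 𝕜 hα, fun k => ?_,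
    fun f => ?_⟩
  · rw [laguerreBasis_apply]
    exact (memLp_laguerreFun hα k).coeFn_toLp
  · refine ((laguerreBasis 𝕜 hα).hasSum_repr (A f)).congr_fun fun k => ?_
    rw [HilbertBasis.repr_apply_apply, inner_laguerreBasis_of_actsOnLpAs hα hA, mul_smul]

theorem laguerreKernel_mul_ae_eq (hα : ∀ i, 0 ≤ α i) {t : ℝ} (ht : 0 < t)
    (f : (Fin d → ℝ) → 𝕜) {x : Fin d → ℝ} (hx : x ∈ orthant d) :
    (fun y => (laguerreKernel α t x y : 𝕜) * f y) =ᵐ[orthantMeasure d]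
      fun y => (laguerreHeatPi α t x y : 𝕜) * f y := by
  filter_upwards [ae_mem_orthant d] with y hy
  rw [laguerreKernel_eq hα ht hx hy]

theorem isLaguerreSemigroup_laguerreSemigroup (hα : ∀ i, 0 ≤ α i) :
    IsLaguerreSemigroup α (laguerreSemigroup 𝕜 hα) where
  zero := laguerreSemigroup_zero hα
  exp_on_L2 t := by
    obtain ⟨A, hA, -⟩ := exists_actsOnLpAs_laguerreSemigroup (𝕜 := 𝕜) hα 2 t
    exact ⟨A, hA, isLaguerreExp_of_actsOnLpAs hα hA⟩
  integrable_kernel t ht f x hx :=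
    ((isSchurKernel_laguerreHeatPi hα (NNReal.coe_pos.2 ht)).integrable_mul f.2 hx).congr
      (laguerreKernel_mul_ae_eq hα (NNReal.coe_pos.2 ht) _ hx).symm
  eq_integral t ht f := by
    filter_upwards [coeFn_laguerreSemigroup hα (NNReal.coe_pos.2 ht) f, ae_mem_orthant d]
      with x h hx
    rw [h, integral_congr_ae (laguerreKernel_mul_ae_eq hα (NNReal.coe_pos.2 ht) _ hx)]
    rfl

theorem IsLaguerreSemigroup.unique
    {T T' : ℝ≥0 → L1AddLinfty 𝕜 (orthantMeasure d) →ₗ[𝕜] ((Fin d → ℝ) →ₘ[orthantMeasure d] 𝕜)}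
    (hT : IsLaguerreSemigroup α T) (hT' : IsLaguerreSemigroup α T') : T = T' := by
  funext t
  rcases eq_or_ne t 0 with rfl | ht
  · rw [hT.zero, hT'.zero]
  · have ht' : 0 < t := pos_iff_ne_zero.2 ht
    exact LinearMap.ext fun f =>
      AEEqFun.ext ((hT.eq_integral t ht' f).trans (hT'.eq_integral t ht' f).symm)

theorem isSelfAdjoint_of_actsOnLpAs (hα : ∀ i, 0 ≤ α i) {t : ℝ≥0}
    {A : Lp 𝕜 2 (orthantMeasure d) →L[𝕜] Lp 𝕜 2 (orthantMeasure d)}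
    (hA : ActsOnLpAs (laguerreSemigroup 𝕜 hα t) 2 A) : IsSelfAdjoint A := by
  rw [ContinuousLinearMap.isSelfAdjoint_iff_isSymmetric]
  intro f g
  change inner 𝕜 (A f) g = inner 𝕜 f (A g)
  rw [← (laguerreBasis 𝕜 hα).tsum_inner_mul_inner, ← (laguerreBasis 𝕜 hα).tsum_inner_mul_inner]
  refine tsum_congr fun k => ?_
  rw [← inner_conj_symm (A f), inner_laguerreBasis_of_actsOnLpAs hα hA,
    inner_laguerreBasis_of_actsOnLpAs hα hA, map_mul, RCLike.conj_ofReal, inner_conj_symm]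
  ring

/-- By Parseval `‖A t f - f‖²` is the sum of `(1 - e^(-tλ_k))² |⟨𝓛_k, f⟩|²`. Dominated convergence
applies since `λ_k ≥ 0` keeps the first factor at most `1`. -/
theorem tendsto_of_actsOnLpAs (hα : ∀ i, 0 ≤ α i)
    {A : ℝ≥0 → Lp 𝕜 2 (orthantMeasure d) →L[𝕜] Lp 𝕜 2 (orthantMeasure d)}
    (hA : ∀ t, ActsOnLpAs (laguerreSemigroup 𝕜 hα t) 2 (A t)) (f : Lp 𝕜 2 (orthantMeasure d)) :
    Tendsto (fun t => A t f) (𝓝[>] 0) (𝓝 f) := by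
  set b := laguerreBasis 𝕜 hα with hb
  have hnorm : ∀ g, ‖g‖ ^ 2 = ∑' k, ‖inner 𝕜 (b k) g‖ ^ 2 := by
    intro g
    have h := lp.norm_rpow_eq_tsum (p := 2) (by norm_num) (b.repr g)
    simpa [HilbertBasis.repr_apply_apply] using h
  have hcoef : ∀ t k, ‖inner 𝕜 (b k) (A t f - f)‖ ^ 2 =
      (1 - Real.exp (-t * laguerreEigenvalue α k)) ^ 2 * ‖inner 𝕜 (b k) f‖ ^ 2 := by
    intro t k
    rw [inner_sub_right, inner_laguerreBasis_of_actsOnLpAs hα (hA t), ← hb,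
      show ∀ u v : 𝕜, u * v - v = -((1 - u) * v) from fun _ _ => by ring, norm_neg, norm_mul,
      mul_pow, ← RCLike.ofReal_one, ← RCLike.ofReal_sub, RCLike.norm_ofReal, sq_abs]
  have key : Tendsto (fun t : ℝ≥0 => ‖A t f - f‖ ^ 2) (𝓝[>] 0) (𝓝 0) := by
    simp only [hnorm, hcoef]
    have := tendsto_tsum_of_dominated_convergence (𝓕 := 𝓝[>] (0 : ℝ≥0))
      (f := fun (t : ℝ≥0) k =>
        (1 - Real.exp (-t * laguerreEigenvalue α k)) ^ 2 * ‖inner 𝕜 (b k) f‖ ^ 2)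
      (g := fun _ => 0) (b.orthonormal.inner_products_summable f) ?_ ?_
    · simpa using this
    · intro k
      have hc : Continuous fun t : ℝ≥0 =>
          (1 - Real.exp (-t * laguerreEigenvalue α k)) ^ 2 * ‖inner 𝕜 (b k) f‖ ^ 2 := by fun_prop
      have := hc.tendsto 0
      simp only [NNReal.coe_zero, neg_zero, zero_mul, Real.exp_zero, sub_self, ne_eq,
        OfNat.ofNat_ne_zero, not_false_eq_true, zero_pow] at this
      exact this.mono_left nhdsWithin_le_nhds
    · refine Eventually.of_forall fun t k => ?_
      rw [norm_mul, Real.norm_of_nonneg (sq_nonneg _), Real.norm_of_nonneg (sq_nonneg _)]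
      refine mul_le_of_le_one_left (sq_nonneg _) ?_
      have h1 := Real.exp_pos (-t * laguerreEigenvalue α k)
      have h2 : Real.exp (-t * laguerreEigenvalue α k) ≤ 1 := by
        rw [Real.exp_le_one_iff, neg_mul, neg_nonpos]
        exact mul_nonneg t.2 (laguerreEigenvalue_nonneg hα k)
      nlinarith
  rw [tendsto_iff_norm_sub_tendsto_zero]
  have := key.sqrt
  simpa using this

theorem isSymmetricDiffusionSemigroup_laguerreSemigroup (hα : ∀ i, 0 ≤ α i) :
    IsSymmetricDiffusionSemigroup (laguerreSemigroup 𝕜 hα) where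
  zero := laguerreSemigroup_zero hα
  contraction_semigroup p _ := by
    choose A hA hAn using exists_actsOnLpAs_laguerreSemigroup (𝕜 := 𝕜) hα p
    refine ⟨A, hA, fun t => (hAn t).trans ?_, ?_, fun s t => ?_⟩
    · exact inv_le_one_of_one_le₀ (one_le_pow₀ (Real.one_le_cosh _))
    · ext1 f
      obtain ⟨hf, h⟩ := hA 0 f
      rw [laguerreSemigroup_zero] at h
      exact Subtype.ext h.symm
    · ext1 f
      obtain ⟨hf, h1⟩ := hA (s + t) f
      obtain ⟨_, h2⟩ := hA t f
      obtain ⟨hf', h3⟩ := hA s (A t f)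
      refine Subtype.ext ?_
      rw [ContinuousLinearMap.comp_apply, ← h1, ← h3]
      have h4 := laguerreSemigroup_add hα s t
        ⟨(f : (Fin d → ℝ) →ₘ[orthantMeasure d] 𝕜), hf⟩ (by rw [h2]; exact hf')
      simp only [h2] at h4
      exact h4.symm
  selfAdjoint _ _ hA := isSelfAdjoint_of_actsOnLpAs hα hA
  tendsto_zero _ hA f := tendsto_of_actsOnLpAs hα hA f

theorem kernelIntegral_laguerreHeatPi_ofReal {t : ℝ} (f : (Fin d → ℝ) → ℝ) (x : Fin d → ℝ) :
    kernelIntegral (orthantMeasure d) (laguerreHeatPi α t) (fun y => (f y : 𝕜)) x =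
      ((∫ y, laguerreHeatPi α t x y * f y ∂orthantMeasure d : ℝ) : 𝕜) := by
  simp only [kernelIntegral, ← RCLike.ofReal_mul]
  rw [integral_ofReal]

theorem laguerreSemigroup_nonneg (hα : ∀ i, 0 ≤ α i) (t : ℝ≥0)
    (f : L1AddLinfty 𝕜 (orthantMeasure d))
    (hf : 0 ≤ (f : (Fin d → ℝ) →ₘ[orthantMeasure d] 𝕜)) : 0 ≤ laguerreSemigroup 𝕜 hα t f := by
  rcases eq_or_ne t 0 with rfl | ht
  · simpa [laguerreSemigroup_zero] using hf
  have ht' : 0 < (t : ℝ) := by positivity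
  have hf' : ∀ᵐ y ∂orthantMeasure d, 0 ≤ (f : (Fin d → ℝ) →ₘ[orthantMeasure d] 𝕜) y := by
    filter_upwards [AEEqFun.coeFn_le.2 hf,
      AEEqFun.coeFn_zero (μ := orthantMeasure d) (β := 𝕜)] with y hy h0
    rwa [h0] at hy
  rw [← AEEqFun.coeFn_le]
  filter_upwards [coeFn_laguerreSemigroup hα ht' f, AEEqFun.coeFn_zero (μ := orthantMeasure d)
    (β := 𝕜), ae_mem_orthant d] with x h h0 hx
  -- A nonnegative element of `𝕜` is its own real part, so the integral reduces to a real one.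
  have e : kernelIntegral (orthantMeasure d) (laguerreHeatPi α t)
      (f : (Fin d → ℝ) →ₘ[orthantMeasure d] 𝕜) x =
      kernelIntegral (orthantMeasure d) (laguerreHeatPi α t)
        (fun y => ((RCLike.re ((f : (Fin d → ℝ) →ₘ[orthantMeasure d] 𝕜) y) : ℝ) : 𝕜)) x := by
    refine integral_congr_ae ?_
    filter_upwards [hf'] with y hy
    rw [RCLike.conj_eq_iff_re.1 (RCLike.conj_eq_iff_im.2 (RCLike.nonneg_iff.1 hy).2)]
  rw [h, h0, e, kernelIntegral_laguerreHeatPi_ofReal, Pi.zero_apply, RCLike.ofReal_nonneg]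
  refine integral_nonneg_of_ae ?_
  filter_upwards [hf', ae_mem_orthant d] with y hy hyo
  exact mul_nonneg (laguerreHeatPi_nonneg hα ht' hx hyo) (RCLike.nonneg_iff.1 hy).1

theorem one_mem_L1AddLinfty :
    (1 : (Fin d → ℝ) →ₘ[orthantMeasure d] 𝕜) ∈ L1AddLinfty 𝕜 (orthantMeasure d) := by
  refine memLp_mem_L1AddLinfty le_top ((memLp_congr_ae AEEqFun.coeFn_one).2 ?_)
  exact memLp_top_const 1

theorem laguerreSemigroup_one (hα : ∀ i, 0 ≤ α i) {t : ℝ≥0} (ht : 0 < (t : ℝ))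
    (h : (1 : (Fin d → ℝ) →ₘ[orthantMeasure d] 𝕜) ∈ L1AddLinfty 𝕜 (orthantMeasure d)) :
    laguerreSemigroup 𝕜 hα t ⟨1, h⟩ =ᵐ[orthantMeasure d]
      fun x => ((∫ y, laguerreHeatPi α t x y ∂orthantMeasure d : ℝ) : 𝕜) := by
  filter_upwards [coeFn_laguerreSemigroup hα ht ⟨1, h⟩] with x hx
  rw [hx, ← integral_ofReal]
  refine integral_congr_ae ?_
  filter_upwards [AEEqFun.coeFn_one (μ := orthantMeasure d) (β := 𝕜)] with y hy
  rw [hy, Pi.one_apply, mul_one]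

theorem isSubmarkovian_laguerreSemigroup (hα : ∀ i, 0 ≤ α i) :
    IsSubmarkovian (laguerreSemigroup 𝕜 hα) where
  toIsSymmetricDiffusionSemigroup := isSymmetricDiffusionSemigroup_laguerreSemigroup hα
  positive := laguerreSemigroup_nonneg hα
  map_one_le t := by
    refine ⟨one_mem_L1AddLinfty, ?_⟩
    rcases eq_or_ne t 0 with rfl | ht
    · simp [laguerreSemigroup_zero]
    have ht' : 0 < (t : ℝ) := by positivity
    rw [← AEEqFun.coeFn_le]
    filter_upwards [laguerreSemigroup_one (𝕜 := 𝕜) hα ht' one_mem_L1AddLinfty,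
      AEEqFun.coeFn_one (μ := orthantMeasure d) (β := 𝕜), ae_mem_orthant d] with x h h1 hx
    rw [h, h1, Pi.one_apply, ← RCLike.ofReal_one, RCLike.ofReal_le_ofReal]
    exact (integral_laguerreHeatPi_le hα ht' hx).trans
      (inv_le_one_of_one_le₀ (one_le_pow₀ (Real.one_le_cosh _)))

/-- A nonzero measure allows an actual point to be drawn from an almost-everywhere statement, as the
failure of conservativity requires. -/
instance : NeZero (orthantMeasure d) := by
  refine ⟨fun h => ?_⟩
  rw [orthantMeasure, Measure.restrict_eq_zero] at h
  have ho : IsOpen (orthant d) := by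
    rw [orthant_eq_pi]
    exact isOpen_set_pi Set.finite_univ fun _ _ => isOpen_Ioi
  exact (ho.measure_pos volume ⟨1, fun _ => one_pos⟩).ne' h

/-- At time `1`, conservativity would force the kernel to have mass `1` at some point, against the
bound `cosh (1/2)^(-d) < 1`; strictness needs `d ≠ 0`. -/
theorem not_isMarkovian_laguerreSemigroup (hd : d ≠ 0) (hα : ∀ i, 0 ≤ α i) :
    ¬ IsMarkovian (laguerreSemigroup 𝕜 hα) := by
  intro hM
  obtain ⟨h, h1⟩ := hM.conservative 1
  have ht : 0 < ((1 : ℝ≥0) : ℝ) := by simp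
  have hae := laguerreSemigroup_one hα ht h
  rw [h1] at hae
  obtain ⟨x, hx, hx1, hxo⟩ :=
    (hae.and ((AEEqFun.coeFn_one (μ := orthantMeasure d) (β := 𝕜)).and (ae_mem_orthant d))).exists
  rw [hx1, Pi.one_apply, ← RCLike.ofReal_one, RCLike.ofReal_inj] at hx
  have hle := integral_laguerreHeatPi_le hα ht hxo
  rw [← hx] at hle
  have : 1 < Real.cosh (((1 : ℝ≥0) : ℝ) / 2) := Real.one_lt_cosh.2 (by simp)
  exact absurd hle (not_le.2 (inv_lt_one_of_one_lt₀ (one_lt_pow₀ this hd)))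

end LaguerreSemigroup

theorem mainTheorem2 {𝕜 : Type*} [RCLike 𝕜] (d : ℕ) (hd : 1 ≤ d) (α : Fin d → ℝ)
    (hα : ∀ i, 0 ≤ α i) :
    (∃! T : ℝ≥0 → L1AddLinfty 𝕜 (orthantMeasure d) →ₗ[𝕜]
        ((Fin d → ℝ) →ₘ[orthantMeasure d] 𝕜), IsLaguerreSemigroup α T) ∧
    ∀ T : ℝ≥0 → L1AddLinfty 𝕜 (orthantMeasure d) →ₗ[𝕜]
        ((Fin d → ℝ) →ₘ[orthantMeasure d] 𝕜), IsLaguerreSemigroup α T →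
      IsSubmarkovian T ∧ ¬ IsMarkovian T ∧
      ∀ (p : ℝ≥0∞) [Fact (1 ≤ p)] (t : ℝ≥0), 0 < t →
        ∃ A : Lp 𝕜 p (orthantMeasure d) →L[𝕜] Lp 𝕜 p (orthantMeasure d),
          ActsOnLpAs (T t) p A ∧ ‖A‖ ≤ (Real.cosh ((t : ℝ) / 2) ^ d)⁻¹ := by
  have hT := isLaguerreSemigroup_laguerreSemigroup (𝕜 := 𝕜) hα
  refine ⟨⟨laguerreSemigroup 𝕜 hα, hT, fun T h => h.unique hT⟩, fun T h => ?_⟩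
  rw [h.unique hT]
  exact ⟨isSubmarkovian_laguerreSemigroup hα, not_isMarkovian_laguerreSemigroup (by omega) hα,
    fun p _ t _ => exists_actsOnLpAs_laguerreSemigroup hα p t⟩
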